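/- **Setting.** Fix a canonical one-parameter exponential family of reward laws on $[0,1]$ (laws proportional to $e^{\theta x}$ with respect to a nonzero finite reference measure on $[0,1]$, $\theta\in\mathbb R$); its members are identified by their means. An instance is a tuple $\nu=(\nu_i)_{i\in[L]}$ of members with means $\mu_i$; $\nu_\star$ is a law with the largest mean $\mu_\star$, and $\Delta_i=\mu_\star-\mu_i$. For a horizon $T$, an online policy $\pi$ (possibly randomized, possibly depending on $T$) chooses at each time an item from the past pulls and observed rewards, the rewards of item $i$ being i.i.d. from $\nu_i$ and independent across items. The first $T_{\rm FE}=T_{\rm FE}(T)\in\mathbb N$ steps form the free exploration phase, and $T_{i,T_{\rm FE}}$ is the number of pulls of item $i$ in it. With $D$ the Kullback–Leibler divergence and $\frac{\ln T}{0}=\infty$, put $$\widehat{\mathrm{Save}}(\pi;\nu,T_{\rm FE})=\sum_{i:\Delta_i>0}\Delta_i\min\Big\{T_{i,T_{\rm FE}},\tfrac{\ln T}{D(\nu_i,\nu_\star)}\Big\},\qquad \widetilde{\mathrm{Save}}(\pi;\nu,T_{\rm FE})=\sum_{i:\Delta_i>0}\Delta_i\min\Big\{\mathbb E_\nu[T_{i,T_{\rm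 FE}}],\tfrac{\ln T}{D(\nu_i,\nu_\star)}\Big\},$$ and, after relabelling the items so that $\mu_1\ge\dots\ge\mu_L$, $$\mathrm{Save}^*(\nu,T_{\rm FE})=\Delta_{k}\Big(T_{\rm FE}-\sum_{i>k}\tfrac{\ln T}{D(\nu_i,\nu_\star)}\Big)+\sum_{i>k}\tfrac{\Delta_i\ln T}{D(\nu_i,\nu_\star)},\qquad k=\max\Big\{j:\sum_{i\ge j}\tfrac{\ln T}{D(\nu_i,\nu_\star)}\ge T_{\rm FE}\Big\}.$$ The policy $\pi$ is *$(\alpha,\beta)$-probably-saving on $\nu$* if $\mathbb P_\nu\big(\widehat{\mathrm{Save}}(\pi;\nu,T_{\rm FE})\ge\alpha\,\mathrm{Save}^*(\nu,T_{\rm FE})\big)\ge 1-O(T^{-\beta})$ as $T\to\infty$. **The instances.** Let $L=L_g+L_b$ with $L_g,L_b\ge1$, and let $\nu$ be the two-valued instance with mean $\mu_1$ for the items $i\le L_g$ and $\mu_L<\mu_1$ for the items $i>L_g$; $\Delta_L=\mu_1-\mu_L$. Let $\alpha\in(\frac12,1)$, $\beta\in(0,1)$, $\gamma>0$, and let $T_{\rm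 FE}\sim\frac{\gamma L_b\ln T}{D(\nu_L,\nu_1)}$ as $T\to\infty$. Let $\xi_1,\xi_3>0$ and let $\nu^{(1)},\nu^{(3)}$ be instances in the same family with means $$\mu^{(1)}_i=\tfrac{\mu_1+\mu_L-\xi_1}{2}\ (i\le L_g),\quad \mu^{(1)}_i=\tfrac{\mu_1+\mu_L+\xi_1}{2}\ (i>L_g);\qquad \mu^{(3)}_i=\mu_L-\xi_3\ (i\le L_g),\quad \mu_i^{(3)}=\mu_L\ (i>L_g),$$ such that $\frac{L_g\ln T}{D(\nu^{(j)}_1,\nu^{(j)}_L)}\ge T_{\rm FE}$ for $j=1,3$ and all large $T$. Put $$\underline r_1=\frac{\beta D(\nu_L,\nu_1)}{L_b\max\{D(\nu_1,\nu^{(1)}_1),D(\nu_L,\nu^{(1)}_L)\}},\qquad \underline r_2=\min\Big\{1+\frac{\beta D(\nu_L,\nu_1)}{L_bD(\nu_1,\nu^{(3)}_1)},\frac{\alpha}{1-\alpha}\Big\},\qquad \overline{\mathfrak S}(\pi,\nu)=\limsup_{T\to\infty}\frac{\widetilde{\mathrm{Save}}(\pi;\nu,T_{\rm FE})}{\ln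 T}.$$ **Theorem.** (i) If $\gamma<\underline r_1$ and $\gamma<\frac{\alpha}{1-\alpha}$ (the latter is automatic when $\underline r_1\le\underline r_2$), then no policy is $(\alpha,\beta)$-probably-saving on both $\nu$ and $\nu^{(1)}$. If $\pi$ is $(\alpha,\beta)$-probably-saving on $\nu,\nu^{(1)},\nu^{(3)}$, then $$\overline{\mathfrak S}(\pi,\nu)\le\Delta_L\Big(\frac{\gamma L_b}{D(\nu_L,\nu_1)}-\frac{\beta}{D(\nu_1,\nu_1^{(3)})}\Big)\quad\text{if }\underline r_1\le\gamma\le\underline r_2\text{ and }\gamma<\tfrac{\alpha}{1-\alpha},\qquad \overline{\mathfrak S}(\pi,\nu)\le\Delta_L\frac{L_b}{D(\nu_L,\nu_1)}\quad\text{if }\gamma\ge\underline r_2 .$$ (ii) Let $\pi$ be $(\alpha,\beta)$-probably-saving on $\nu,\nu^{(1)},\nu^{(3)}$ and suppose that $\nu^{(2)}$ exists: for some $1\le L_g'<L_g$ and $\xi_2>\frac{1-\alpha}{2\alpha-1}\Delta_L$ there is an instance $\nu^{(2)}$ in the family with $$\mu^{(2)}_i=\mu_1\ (i\le L_g'),\qquad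 \mu_i^{(2)}=\mu_L-\xi_2\ (L_g'<i\le L_g),\qquad \mu^{(2)}_i=\mu_L\ (i>L_g),$$ and, with $L_c=L_g-L_g'$, $\frac{L_c\ln T}{D(\nu^{(2)}_{L_g},\nu^{(2)}_1)}\ge T_{\rm FE}$ for all large $T$. Suppose that either $\pi$ is $(\alpha,\beta)$-probably-saving on every instance obtained from $\nu^{(2)}$ by permuting the labels of the good items $[L_g]$ (and of the bad items), or $\pi$ is so on $\nu^{(2)}$ and, for all large $T$, $\mathbb E_\nu[T_{i,T_{\rm FE}}]\le\mathbb E_\nu[T_{j,T_{\rm FE}}]$ whenever $j\le L_g'<i\le L_g$. Then for $\underline r_1\le\gamma\le1$ $$\overline{\mathfrak S}(\pi,\nu)\le\Delta_L\Big(\frac{\gamma L_b}{D(\nu_L,\nu_1)}-\frac{\zeta\, L_g\,\beta}{D(\nu_{L_g},\nu_{L_g}^{(2)})}\Big)\qquad\text{with }\zeta=\frac1{L_c}.$$ In particular, if $L_c=\max\Big\{\frac{\gamma L_bD(\nu^{(2)}_{L_g},\nu^{(2)}_1)}{D(\nu_L,\nu_1)},1\Big\}$, this holds with $\zeta=\min\Big\{\frac{D(\nu_L,\nu_1)}{\gamma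 L_b\,D(\nu^{(2)}_{L_g},\nu^{(2)}_1)},1\Big\}$. -/

import Mathlib

open MeasureTheory Filter Topology ProbabilityTheory
open scoped ENNReal

noncomputable section

namespace FreeExploration

/-- A canonical one-parameter exponential family of reward laws supported on `[0, 1]`:
the laws proportional to `exp (θ * x)` with respect to a reference measure `base`. Since
`exp (θ * x)` is bounded above and below on `[0, 1]`, finiteness of `base` is no restriction, and
every real `θ` is a natural parameter. -/
structure ExpFamily where
  base : Measure ℝ
  isFinite : IsFiniteMeasure base
  ne_zero : base ≠ 0
  support : base (Set.Icc (0 : ℝ) 1)ᶜ = 0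

namespace ExpFamily

variable (F : ExpFamily)

/-- The member of the family with natural parameter `θ`. -/
def dist (θ : ℝ) : Measure ℝ := F.base.tilted (fun x => θ * x)

instance (θ : ℝ) : IsProbabilityMeasure (F.dist θ) := by
  have := F.isFinite
  have : NeZero F.base := ⟨F.ne_zero⟩
  refine isProbabilityMeasure_tilted ?_
  refine Integrable.of_bound (by fun_prop) (Real.exp |θ|) ?_
  have h : ∀ᵐ x ∂F.base, x ∈ Set.Icc (0 : ℝ) 1 := by
    rw [ae_iff]; exact F.support
  filter_upwards [h] with x hx
  rw [Real.norm_eq_abs, abs_of_pos (Real.exp_pos _)]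
  refine Real.exp_le_exp.2 ((le_abs_self _).trans ?_)
  rw [abs_mul, abs_of_nonneg hx.1]
  exact mul_le_of_le_one_right (abs_nonneg _) hx.2

/-- The mean of the member with natural parameter `θ`. -/
def mean (θ : ℝ) : ℝ := ∫ x, x ∂(F.dist θ)

/-- The Kullback-Leibler divergence between two members, as a real number (it is finite). -/
def kl (θ θ' : ℝ) : ℝ := (InformationTheory.klDiv (F.dist θ) (F.dist θ')).toReal

end ExpFamily

/-- A bandit instance with `L` items, given by the natural parameters of its reward laws. -/
abbrev Instance (L : ℕ) := Fin L → ℝ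

/-- The instance whose first `Lg` items have parameter `a` and whose other items have parameter
`b`. -/
def twoValued (L Lg : ℕ) (a b : ℝ) : Instance L := fun i => if (i : ℕ) < Lg then a else b

/-- The instance with parameter `a` on the first `Lg'` items, `c` on the following ones up to the
`Lg`-th, and `b` on the remaining items. -/
def threeValued (L Lg' Lg : ℕ) (a c b : ℝ) : Instance L := fun i =>
  if (i : ℕ) < Lg' then a else if (i : ℕ) < Lg then c else b

/-- An online policy, possibly randomized through a private random seed. For each horizon `T`,
`pull T t` chooses the item at time `t` (times start at `0`) from the seed and the history of the
items pulled and rewards observed before time `t`. Deterministic policies ignore the seed. -/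
structure Policy (L : ℕ) where
  seed : Measure ℝ
  isProbability : IsProbabilityMeasure seed
  pull : ℕ → (t : ℕ) → ℝ × (Fin t → Fin L × ℝ) → Fin L
  measurable_pull : ∀ T t, Measurable (pull T t)

namespace Policy

variable {L : ℕ} (π : Policy L)

/-- The history before time `t` when the seed is `u` and item `i` yields the reward `x s i` if it
is pulled at time `s`. -/
def history (T : ℕ) (u : ℝ) (x : ℕ → Fin L → ℝ) : (t : ℕ) → (Fin t → Fin L × ℝ)
  | 0 => Fin.elim0
  | t + 1 =>
    let h := history T u x t
    let i := π.pull T t (u, h)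
    Fin.snoc (α := fun _ => Fin L × ℝ) h (i, x t i)

/-- The item pulled at time `t`. -/
def item (T : ℕ) (ω : ℝ × (ℕ → Fin L → ℝ)) (t : ℕ) : Fin L :=
  π.pull T t (ω.1, π.history T ω.1 ω.2 t)

/-- The number of pulls of item `i` among the first `n` time steps, for horizon `T`. -/
def pulls (T n : ℕ) (i : Fin L) (ω : ℝ × (ℕ → Fin L → ℝ)) : ℕ :=
  ((Finset.range n).filter (fun t => π.item T ω t = i)).card

/-- The joint law of the seed and of the rewards `X t i`, which are independent with
`X t i` distributed as the `i`-th law of the instance. -/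
def law (F : ExpFamily) (ν : Instance L) : Measure (ℝ × (ℕ → Fin L → ℝ)) :=
  π.seed.prod (Measure.infinitePi fun _ : ℕ => Measure.pi fun i => F.dist (ν i))

/-- The expected number of pulls of item `i` among the first `n` time steps. -/
def expPulls (F : ExpFamily) (ν : Instance L) (T n : ℕ) (i : Fin L) : ℝ :=
  ∫ ω, (π.pulls T n i ω : ℝ) ∂(π.law F ν)

end Policy

variable {L : ℕ} [NeZero L] (F : ExpFamily) (ν : Instance L)

/-- The items listed in order of decreasing means. -/
def sorted : Equiv.Perm (Fin L) := Tuple.sort fun i => -F.mean (ν i)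

/-- An optimal item. -/
def best : Fin L := sorted F ν 0

/-- The optimality gap of item `i`. -/
def gap (i : Fin L) : ℝ := F.mean (ν (best F ν)) - F.mean (ν i)

/-- `ln T / D(ν_i, ν_best)`, which is `∞` for optimal items (when `ln T > 0`). -/
def need (T : ℕ) (i : Fin L) : ℝ≥0∞ :=
  ENNReal.ofReal (Real.log T) /
    InformationTheory.klDiv (F.dist (ν i)) (F.dist (ν (best F ν)))

open Classical in
/-- The largest position `j` in the list by decreasing means such that the items from
position `j` on can absorb the budget `n`. -/
def iFE (T n : ℕ) : Fin L :=
  (Finset.univ.filter fun j : Fin L =>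
    (n : ℝ≥0∞) ≤ ∑ k ∈ Finset.Ici j, need F ν T (sorted F ν k)).sup id

/-- The oracle saved regret with free exploration budget `n` and horizon `T`: the items are
explored from the worst one upwards, each for `ln T / D(ν_i, ν_best)` pulls. -/
def oracleSave (T n : ℕ) : ℝ :=
  gap F ν (sorted F ν (iFE F ν T n)) *
      ((n : ℝ) - ∑ k ∈ Finset.Ioi (iFE F ν T n), (need F ν T (sorted F ν k)).toReal)
    + ∑ k ∈ Finset.Ioi (iFE F ν T n),
        gap F ν (sorted F ν k) * (need F ν T (sorted F ν k)).toReal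

open Classical in
/-- The quantity `∑_{i : Δ_i > 0} Δ_i * min (N_i, ln T / D(ν_i, ν_best))` for pull counts `N`. -/
def savedBy (T : ℕ) (N : Fin L → ℝ) : ℝ :=
  ∑ i with 0 < gap F ν i,
    gap F ν i * min (N i) (Real.log T / F.kl (ν i) (ν (best F ν)))

/-- The empirical saved regret. -/
def empSave (π : Policy L) (T n : ℕ) (ω : ℝ × (ℕ → Fin L → ℝ)) : ℝ :=
  savedBy F ν T fun i => (π.pulls T n i ω : ℝ)

/-- The saved regret computed from the expected numbers of pulls. -/
def meanSave (π : Policy L) (T n : ℕ) : ℝ :=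
  savedBy F ν T fun i => π.expPulls F ν T n i

/-- `π` is `(α, β)`-probably-saving on the instance `ν` for the free exploration budgets
`TFE T`: as `T → ∞`, at least an `α`-fraction of the oracle saved regret is saved with probability
at least `1 - O(T ^ (-β))`. -/
def ProbablySaving (α β : ℝ) (TFE : ℕ → ℕ) (π : Policy L) : Prop :=
  ∃ C : ℝ, ∀ᶠ T : ℕ in atTop,
    1 - C * (T : ℝ) ^ (-β) ≤
      (π.law F ν).real
        {ω | α * oracleSave F ν T (TFE T) ≤ empSave F ν π T (TFE T) ω}

/-- The asymptotic normalized saved regret `limsup_T meanSave / ln T`. -/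
def limsupSave (TFE : ℕ → ℕ) (π : Policy L) : ℝ :=
  limsup (fun T : ℕ => meanSave F ν π T (TFE T) / Real.log T) atTop

end FreeExploration

end

open FreeExploration

/-! The theorem rests on one change-of-measure argument. Suppose that no trajectory saves enough on
both `ν` and an alternative `ν'`. Then the event "enough is saved on `ν`" has probability `1 - O(T ^
(-β))` under `ν` and `O(T ^ (-β))` under `ν'`. A Donsker-Varadhan inequality, together with the
divergence decomposition along the policy, forces `∑ i, E_ν[N_i] * kl (ν i) (ν' i) ≥ (β - ε) * log
T` (`mul_prob_le_sum_expPulls_mul_kl_add_log`, `eventually_le_sum_expPulls_mul_kl`).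

Incompatibility is a count of pulls. Saving on `ν` takes at least `α * min (TFE, Lb * log T / D)`
pulls of bad items. Saving on an instance with the two groups reversed takes at least `α * TFE`
pulls of good items, and together these exceed the budget when `γ < α / (1 - α)`. When some good
items become much worse than the bad ones and `γ ≤ 1`, the bad items save too little on the
alternative, and the lower bound on `ξ₂` makes this a contradiction.

Each alternative then turns the information bound into one regime. Under `ν₁` every pull is
informative, but yields at most the larger divergence; the whole budget must therefore reach `β *
log T`, which excludes `γ < r₁`. Under `ν₃` only good items change, so `β / kl a a₃ * log T` pulls
are spent on good items and save nothing. Under `ν₂` only `Lg - Lg'` good items must receive that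
many pulls, with `kl a c` in place of `kl a a₃`; averaging over cyclic relabellings, or the assumed
ordering of the pulls, raises the bound for the whole good group by the factor `Lg / (Lg - Lg')`.
The remaining bound is the truncation of each item's saving. -/

namespace FreeExploration

/-! ### Likelihood ratios and divergences in the exponential family -/

namespace ExpFamily

variable (F : ExpFamily)

lemma ae_base_mem_Icc : ∀ᵐ x ∂F.base, x ∈ Set.Icc (0 : ℝ) 1 := by
  rw [ae_iff]; exact F.support

lemma ae_dist_mem_Icc (θ : ℝ) : ∀ᵐ x ∂F.dist θ, x ∈ Set.Icc (0 : ℝ) 1 :=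
  (tilted_absolutelyContinuous F.base _).ae_le F.ae_base_mem_Icc

lemma abs_mul_le_of_mem_Icc {x : ℝ} (hx : x ∈ Set.Icc (0 : ℝ) 1) (θ : ℝ) : |θ * x| ≤ |θ| := by
  rw [abs_mul, abs_of_nonneg hx.1]
  exact mul_le_of_le_one_right (abs_nonneg _) hx.2

lemma integrable_exp_of_ae_mem_Icc {μ : Measure ℝ} [IsFiniteMeasure μ]
    (h : ∀ᵐ x ∂μ, x ∈ Set.Icc (0 : ℝ) 1) (θ : ℝ) : Integrable (fun x => Real.exp (θ * x)) μ := by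
  refine Integrable.of_bound (by fun_prop) (Real.exp |θ|) ?_
  filter_upwards [h] with x hx
  rw [Real.norm_eq_abs, abs_of_pos (Real.exp_pos _)]
  exact Real.exp_le_exp.2 ((le_abs_self _).trans (abs_mul_le_of_mem_Icc hx θ))

/-- Tilts compose, so any member can serve as reference measure for any other; this gives mutual
absolute continuity and an affine log-likelihood ratio. -/
lemma dist_eq_tilted (θ θ' : ℝ) : F.dist θ' = (F.dist θ).tilted (fun x => (θ' - θ) * x) := by
  have := F.isFinite
  rw [dist, dist, tilted_tilted (integrable_exp_of_ae_mem_Icc F.ae_base_mem_Icc θ)]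
  congr 1
  ext x
  simp only [Pi.add_apply]
  ring

/-- The log-likelihood ratio of the members with parameters `θ` and `θ'`. -/
noncomputable def logRatio (θ θ' y : ℝ) : ℝ :=
  (θ - θ') * y + Real.log (∫ x, Real.exp ((θ' - θ) * x) ∂F.dist θ)

@[fun_prop]
lemma measurable_logRatio (θ θ' : ℝ) : Measurable (F.logRatio θ θ') := by
  unfold logRatio; fun_prop

lemma integrable_logRatio (θ θ' : ℝ) : Integrable (F.logRatio θ θ') (F.dist θ) := by
  refine Integrable.add ?_ (integrable_const _)
  refine Integrable.of_bound (by fun_prop) |θ - θ'| ?_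
  filter_upwards [F.ae_dist_mem_Icc θ] with x hx using abs_mul_le_of_mem_Icc hx _

lemma lintegral_dist (θ θ' : ℝ) (g : ℝ → ℝ≥0∞) :
    ∫⁻ y, g y ∂F.dist θ' =
      ∫⁻ y, g y * ENNReal.ofReal (Real.exp (-F.logRatio θ θ' y)) ∂F.dist θ := by
  rw [F.dist_eq_tilted θ θ', lintegral_tilted]
  refine lintegral_congr fun y => ?_
  have hpos := integral_exp_pos (integrable_exp_of_ae_mem_Icc (F.ae_dist_mem_Icc θ) (θ' - θ))
  rw [mul_comm, logRatio, neg_add, Real.exp_add, Real.exp_neg (Real.log _), Real.exp_log hpos,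
    div_eq_mul_inv]
  congr 4
  ring

lemma llr_dist_ae (θ θ' : ℝ) :
    llr (F.dist θ) (F.dist θ') =ᵐ[F.dist θ] F.logRatio θ θ' := by
  rw [F.dist_eq_tilted θ θ']
  have hi := integrable_exp_of_ae_mem_Icc (F.ae_dist_mem_Icc θ) (θ' - θ)
  filter_upwards [llr_tilted_right (μ := F.dist θ) Measure.AbsolutelyContinuous.rfl hi,
    llr_self (F.dist θ)] with x hx hx'
  rw [hx, hx', logRatio]
  simp only [Pi.zero_apply]
  ring

lemma dist_absolutelyContinuous (θ θ' : ℝ) : F.dist θ ≪ F.dist θ' := by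
  rw [F.dist_eq_tilted θ' θ]
  exact tilted_absolutelyContinuous _ _

/-- The log-likelihood ratio is affine and the support is bounded, so it is integrable. -/
lemma klDiv_dist_ne_top (θ θ' : ℝ) :
    InformationTheory.klDiv (F.dist θ) (F.dist θ') ≠ ∞ :=
  InformationTheory.klDiv_ne_top (F.dist_absolutelyContinuous θ θ')
    ((integrable_congr (F.llr_dist_ae θ θ')).2 (F.integrable_logRatio θ θ'))

lemma integral_logRatio (θ θ' : ℝ) : ∫ y, F.logRatio θ θ' y ∂F.dist θ = F.kl θ θ' := by
  rw [kl, InformationTheory.toReal_klDiv_of_measure_eq (F.dist_absolutelyContinuous θ θ')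
    (by simp), integral_congr_ae (F.llr_dist_ae θ θ')]

lemma kl_self (θ : ℝ) : F.kl θ θ = 0 := by
  simp [kl]

lemma kl_nonneg (θ θ' : ℝ) : 0 ≤ F.kl θ θ' := ENNReal.toReal_nonneg

lemma klDiv_dist_ne_zero {θ θ' : ℝ} (h : F.mean θ ≠ F.mean θ') :
    InformationTheory.klDiv (F.dist θ) (F.dist θ') ≠ 0 := by
  rw [Ne, InformationTheory.klDiv_eq_zero_iff]
  intro h'
  exact h (by rw [mean, mean, h'])

lemma kl_pos {θ θ' : ℝ} (h : F.mean θ ≠ F.mean θ') : 0 < F.kl θ θ' :=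
  ENNReal.toReal_pos (F.klDiv_dist_ne_zero h) (F.klDiv_dist_ne_top θ θ')

lemma ofReal_kl (θ θ' : ℝ) :
    ENNReal.ofReal (F.kl θ θ') = InformationTheory.klDiv (F.dist θ) (F.dist θ') :=
  ENNReal.ofReal_toReal (F.klDiv_dist_ne_top θ θ')

end ExpFamily

/-! ### Histories, independence of fresh rewards, and change of measure -/

namespace Policy

variable {L : ℕ} (π : Policy L)

/-- The seed together with the history before time `t`. -/
def record (T t : ℕ) (ω : ℝ × (ℕ → Fin L → ℝ)) : ℝ × (Fin t → Fin L × ℝ) :=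
  (ω.1, π.history T ω.1 ω.2 t)

lemma history_succ (T : ℕ) (u : ℝ) (x : ℕ → Fin L → ℝ) (t : ℕ) :
    π.history T u x (t + 1) =
      Fin.snoc (α := fun _ => Fin L × ℝ) (π.history T u x t)
        (π.pull T t (u, π.history T u x t), x t (π.pull T t (u, π.history T u x t))) := rfl

lemma item_eq_pull (T : ℕ) (ω : ℝ × (ℕ → Fin L → ℝ)) (t : ℕ) :
    π.item T ω t = π.pull T t (π.record T t ω) := rfl

/-- The record after one more step, in which item `i` would yield the reward `z i`. -/
def extend (T t : ℕ) (p : (ℝ × (Fin t → Fin L × ℝ)) × (Fin L → ℝ)) :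
    ℝ × (Fin (t + 1) → Fin L × ℝ) :=
  (p.1.1, Fin.snoc (α := fun _ => Fin L × ℝ) p.1.2 (π.pull T t p.1, p.2 (π.pull T t p.1)))

lemma record_succ (T t : ℕ) (ω : ℝ × (ℕ → Fin L → ℝ)) :
    π.record T (t + 1) ω = π.extend T t (π.record T t ω, ω.2 t) := rfl

lemma measurable_eval_of_countable {α : Type*} [MeasurableSpace α] {f : α → Fin L}
    {g : α → Fin L → ℝ} (hf : Measurable f) (hg : Measurable g) :
    Measurable fun p => g p (f p) := by
  have : Measurable fun q : Fin L × (Fin L → ℝ) => q.2 q.1 :=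
    measurable_from_prod_countable_right fun i => measurable_pi_apply i
  exact this.comp (hf.prodMk hg)

@[fun_prop]
lemma measurable_extend (T t : ℕ) : Measurable (π.extend T t) := by
  refine Measurable.prodMk (by fun_prop) (measurable_pi_iff.2 ?_)
  have hp : Measurable fun p : (ℝ × (Fin t → Fin L × ℝ)) × (Fin L → ℝ) => π.pull T t p.1 :=
    (π.measurable_pull T t).comp measurable_fst
  refine Fin.lastCases ?_ fun s => ?_
  · simp only [Fin.snoc_last]
    exact hp.prodMk (measurable_eval_of_countable hp measurable_snd)
  · simp only [Fin.snoc_castSucc]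
    fun_prop

@[fun_prop]
lemma measurable_record (T t : ℕ) : Measurable (π.record T t) := by
  induction t with
  | zero =>
    exact Measurable.prodMk (by fun_prop) (measurable_pi_iff.2 fun i => i.elim0)
  | succ t ih =>
    change Measurable fun ω => π.extend T t (π.record T t ω, ω.2 t)
    fun_prop

lemma measurable_item (T t : ℕ) : Measurable fun ω => π.item T ω t :=
  (π.measurable_pull T t).comp (π.measurable_record T t)

lemma history_congr {T : ℕ} {u : ℝ} {x x' : ℕ → Fin L → ℝ} {t : ℕ}
    (h : ∀ s < t, x s = x' s) : π.history T u x t = π.history T u x' t := by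
  induction t with
  | zero => rfl
  | succ t ih =>
    rw [history_succ, history_succ, ih fun s hs => h s (hs.trans (Nat.lt_succ_self t)),
      h t (Nat.lt_succ_self t)]

lemma history_apply (T : ℕ) (u : ℝ) (x : ℕ → Fin L → ℝ) (t : ℕ) (s : Fin t) :
    π.history T u x t s = (π.item T (u, x) s, x s (π.item T (u, x) s)) := by
  induction t with
  | zero => exact s.elim0
  | succ t ih =>
    rw [history_succ]
    refine Fin.lastCases ?_ (fun s => ?_) s
    · rw [Fin.snoc_last]; rfl
    · rw [Fin.snoc_castSucc, ih]; rfl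

lemma record_apply_fst (T : ℕ) (ω : ℝ × (ℕ → Fin L → ℝ)) (t : ℕ) (s : Fin t) :
    (π.record T t ω).2 s = (π.item T ω s, ω.2 s (π.item T ω s)) :=
  π.history_apply T ω.1 ω.2 t s

section Law

variable (F : ExpFamily) (ν ν' : Instance L)

instance : IsProbabilityMeasure (π.law F ν) := by
  have := π.isProbability
  unfold law; infer_instance

/-- Replace the rewards at time `t`. -/
def resample (t : ℕ) (p : (ℝ × (ℕ → Fin L → ℝ)) × (Fin L → ℝ)) : ℝ × (ℕ → Fin L → ℝ) :=
  (p.1.1, Function.update p.1.2 t p.2)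

/-- On a cylinder the fresh copy takes over the factor of coordinate `t`, which has the same law.
This expresses the independence of the time-`t` rewards from the past as an invariance, without
conditional expectations. -/
lemma measurePreserving_update_infinitePi (μ : Measure (Fin L → ℝ)) [IsProbabilityMeasure μ]
    (t : ℕ) :
    MeasurePreserving (fun p : (ℕ → Fin L → ℝ) × (Fin L → ℝ) => Function.update p.1 t p.2)
      ((Measure.infinitePi fun _ : ℕ => μ).prod μ) (Measure.infinitePi fun _ : ℕ => μ) := by
  have hm : Measurable fun p : (ℕ → Fin L → ℝ) × (Fin L → ℝ) => Function.update p.1 t p.2 := by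
    refine measurable_pi_iff.2 fun s => ?_
    by_cases hs : s = t
    · subst hs; simp only [Function.update_self]; fun_prop
    · simp only [Function.update_of_ne hs]; fun_prop
  refine ⟨hm, Measure.eq_infinitePi _ fun s B hB => ?_⟩
  rw [Measure.map_apply hm (MeasurableSet.pi (Finset.countable_toSet s) fun i _ => hB i)]
  have hset : (fun p : (ℕ → Fin L → ℝ) × (Fin L → ℝ) => Function.update p.1 t p.2) ⁻¹'
      (Set.pi s B) = (Set.pi (s.erase t : Finset ℕ) B) ×ˢ (if t ∈ s then B t else Set.univ) := by
    ext p
    simp only [Set.mem_preimage, Set.mem_pi, Set.mem_prod, Finset.mem_coe, Finset.mem_erase]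
    constructor
    · intro h
      refine ⟨fun i hi => ?_, ?_⟩
      · simpa [Function.update_of_ne hi.1] using h i hi.2
      · split_ifs with ht
        · simpa using h t ht
        · trivial
    · rintro ⟨h1, h2⟩ i hi
      by_cases hit : i = t
      · subst hit; simpa [hi] using h2
      · simpa [Function.update_of_ne hit] using h1 i ⟨hit, hi⟩
  rw [hset, Measure.prod_prod, Measure.infinitePi_pi _ fun i _ => hB i]
  split_ifs with ht
  · rw [mul_comm, Finset.mul_prod_erase s (fun i => μ (B i)) ht]
  · rw [measure_univ, mul_one, Finset.erase_eq_of_notMem ht]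

lemma measurePreserving_resample (t : ℕ) :
    MeasurePreserving (resample (L := L) t)
      ((π.law F ν).prod (Measure.pi fun i => F.dist (ν i))) (π.law F ν) := by
  have := π.isProbability
  have h := ((MeasurePreserving.id π.seed).prod
    (measurePreserving_update_infinitePi (Measure.pi fun i => F.dist (ν i)) t)).comp
    (measurePreserving_prodAssoc π.seed
      (Measure.infinitePi fun _ : ℕ => Measure.pi fun i => F.dist (ν i))
      (Measure.pi fun i => F.dist (ν i)))
  exact h

lemma record_resample (T t : ℕ) (p : (ℝ × (ℕ → Fin L → ℝ)) × (Fin L → ℝ)) :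
    π.record T t (resample t p) = π.record T t p.1 := by
  simp only [record, resample, Prod.mk.injEq, true_and]
  exact π.history_congr fun s hs => Function.update_of_ne hs.ne _ _

/-- The rewards at time `t` are independent of the record before time `t`. -/
lemma lintegral_record_succ (T t : ℕ) {f : ℝ × (Fin (t + 1) → Fin L × ℝ) → ℝ≥0∞}
    (hf : Measurable f) :
    ∫⁻ ω, f (π.record T (t + 1) ω) ∂π.law F ν =
      ∫⁻ ω, ∫⁻ z, f (π.extend T t (π.record T t ω, z)) ∂(Measure.pi fun i => F.dist (ν i))
        ∂π.law F ν := by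
  have hm : Measurable fun ω => f (π.record T (t + 1) ω) := hf.comp (π.measurable_record T _)
  rw [← (π.measurePreserving_resample F ν t).lintegral_comp hm, lintegral_prod]
  · refine lintegral_congr fun ω => lintegral_congr fun z => ?_
    rw [record_succ, record_resample]
    simp [resample]
  · exact (hm.comp (π.measurePreserving_resample F ν t).measurable).aemeasurable

/-- The log-likelihood ratio of two instances along a history. -/
noncomputable def logLik {t : ℕ} (h : Fin t → Fin L × ℝ) : ℝ :=
  ∑ s, F.logRatio (ν (h s).1) (ν' (h s).1) (h s).2

@[fun_prop]
lemma measurable_logLik (t : ℕ) : Measurable (logLik F ν ν' (t := t)) := by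
  refine Finset.measurable_sum _ fun s _ => ?_
  have : Measurable fun q : Fin L × ℝ => F.logRatio (ν q.1) (ν' q.1) q.2 :=
    measurable_from_prod_countable_right fun i => F.measurable_logRatio (ν i) (ν' i)
  exact this.comp (measurable_pi_apply s)

lemma lintegral_pi_eval (i : Fin L) {g : ℝ → ℝ≥0∞} (hg : Measurable g) :
    ∫⁻ z, g (z i) ∂(Measure.pi fun i => F.dist (ν i)) = ∫⁻ y, g y ∂F.dist (ν i) :=
  (measurePreserving_eval (fun i => F.dist (ν i)) i).lintegral_comp hg

/-- The change of measure between two instances. -/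
lemma lintegral_record (T t : ℕ) {f : ℝ × (Fin t → Fin L × ℝ) → ℝ≥0∞} (hf : Measurable f) :
    ∫⁻ ω, f (π.record T t ω) ∂π.law F ν' =
      ∫⁻ ω, f (π.record T t ω) *
        ENNReal.ofReal (Real.exp (-logLik F ν ν' (π.record T t ω).2)) ∂π.law F ν := by
  have := π.isProbability
  induction t with
  | zero =>
    -- Before the first pull the record is the seed alone, whose law is the same for all instances.
    have key (ν : Instance L) : ∫⁻ ω, f (π.record T 0 ω) ∂π.law F ν =
        ∫⁻ u, f (u, Fin.elim0) ∂π.seed := by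
      have hm : Measurable fun ω => f (π.record T 0 ω) := hf.comp (π.measurable_record T 0)
      rw [law, lintegral_prod _ hm.aemeasurable]
      refine lintegral_congr fun u => ?_
      change ∫⁻ _, f (u, Fin.elim0) ∂_ = _
      simp
    simp only [logLik, Finset.univ_eq_empty, Finset.sum_empty, neg_zero, Real.exp_zero,
      ENNReal.ofReal_one, mul_one, key]
  | succ t ih =>
    rw [π.lintegral_record_succ F ν' T t hf,
      ih (f := fun r => ∫⁻ z, f (π.extend T t (r, z)) ∂(Measure.pi fun i => F.dist (ν' i)))
        (Measurable.lintegral_prod_right' (hf.comp (π.measurable_extend T t))),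
      π.lintegral_record_succ F ν T t (f := fun r => f r *
        ENNReal.ofReal (Real.exp (-logLik F ν ν' r.2))) (by fun_prop)]
    refine lintegral_congr fun ω => ?_
    set r := π.record T t ω
    set i := π.pull T t r with hi
    have hsnoc : Measurable fun y : ℝ =>
        ((r.1, Fin.snoc (α := fun _ => Fin L × ℝ) r.2 (i, y)) : ℝ × (Fin (t + 1) → Fin L × ℝ)) := by
      refine Measurable.prodMk (by fun_prop) (measurable_pi_iff.2 ?_)
      refine Fin.lastCases ?_ fun s => ?_
      · simp only [Fin.snoc_last]; fun_prop
      · simp only [Fin.snoc_castSucc]; fun_prop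
    have hfs : Measurable fun y : ℝ => f (r.1, Fin.snoc (α := fun _ => Fin L × ℝ) r.2 (i, y)) :=
      hf.comp hsnoc
    have hlog (y : ℝ) : logLik F ν ν' (Fin.snoc (α := fun _ => Fin L × ℝ) r.2 (i, y)) =
        logLik F ν ν' r.2 + F.logRatio (ν i) (ν' i) y := by
      simp [logLik, Fin.sum_univ_castSucc]
    -- Given the record, only the reward of the pulled item enters, so the integral over all rewards
    -- reduces to one reward law, where the one-step likelihood ratio applies.
    calc (∫⁻ z, f (π.extend T t (r, z)) ∂(Measure.pi fun i => F.dist (ν' i))) *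
          ENNReal.ofReal (Real.exp (-logLik F ν ν' r.2))
        = (∫⁻ y, f (r.1, Fin.snoc (α := fun _ => Fin L × ℝ) r.2 (i, y)) ∂F.dist (ν' i)) *
          ENNReal.ofReal (Real.exp (-logLik F ν ν' r.2)) := by
          rw [← lintegral_pi_eval F ν' i hfs]; rfl
      _ = ∫⁻ y, f (r.1, Fin.snoc (α := fun _ => Fin L × ℝ) r.2 (i, y)) *
          ENNReal.ofReal (Real.exp (-logLik F ν ν'
            (Fin.snoc (α := fun _ => Fin L × ℝ) r.2 (i, y)))) ∂F.dist (ν i) := by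
          rw [F.lintegral_dist (ν i) (ν' i), ← lintegral_mul_const]
          · refine lintegral_congr fun y => ?_
            rw [hlog, neg_add_rev, Real.exp_add, ENNReal.ofReal_mul (Real.exp_pos _).le, mul_assoc]
          · exact hfs.mul (by fun_prop)
      _ = _ := by
          rw [← lintegral_pi_eval F ν i]
          · rfl
          · exact hfs.mul (ENNReal.measurable_ofReal.comp (Real.measurable_exp.comp
              ((measurable_logLik F ν ν' (t + 1)).comp (measurable_snd.comp hsnoc)).neg))

end Law

end Policy

/-! ### Pull counts, divergence decomposition and the transportation inequality -/

namespace Policy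

variable {L : ℕ} (π : Policy L)

lemma pulls_eq_sum (T n : ℕ) (i : Fin L) (ω : ℝ × (ℕ → Fin L → ℝ)) :
    (π.pulls T n i ω : ℝ) = ∑ t ∈ Finset.range n, if π.item T ω t = i then (1 : ℝ) else 0 := by
  simp [pulls]

lemma sum_pulls (T n : ℕ) (ω : ℝ × (ℕ → Fin L → ℝ)) :
    ∑ i, (π.pulls T n i ω : ℝ) = n := by
  simp_rw [pulls_eq_sum]
  rw [Finset.sum_comm]
  simp

lemma pulls_eq_of_record (T n : ℕ) (i : Fin L) (ω : ℝ × (ℕ → Fin L → ℝ)) :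
    π.pulls T n i ω =
      (Finset.univ.filter fun s : Fin n => ((π.record T n ω).2 s).1 = i).card := by
  simp_rw [record_apply_fst]
  rw [pulls, Finset.card_filter, Finset.card_filter, Finset.sum_range]

lemma measurable_item_ite (T t : ℕ) (i : Fin L) :
    Measurable fun ω => if π.item T ω t = i then (1 : ℝ) else 0 :=
  Measurable.ite (π.measurable_item T t (measurableSet_singleton i)) measurable_const
    measurable_const

section Law

variable (F : ExpFamily) (ν ν' : Instance L)

lemma integrable_item_ite (T t : ℕ) (i : Fin L) :
    Integrable (fun ω => if π.item T ω t = i then (1 : ℝ) else 0) (π.law F ν) := by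
  refine Integrable.of_bound (π.measurable_item_ite T t i).aestronglyMeasurable 1
    (Eventually.of_forall fun ω => ?_)
  split_ifs <;> simp

lemma integrable_pulls (T n : ℕ) (i : Fin L) :
    Integrable (fun ω => (π.pulls T n i ω : ℝ)) (π.law F ν) := by
  simp_rw [pulls_eq_sum]
  exact integrable_finsetSum _ fun t _ => π.integrable_item_ite F ν T t i

lemma expPulls_eq_sum (T n : ℕ) (i : Fin L) :
    π.expPulls F ν T n i =
      ∑ t ∈ Finset.range n, ∫ ω, (if π.item T ω t = i then (1 : ℝ) else 0) ∂π.law F ν := by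
  simp_rw [expPulls, pulls_eq_sum]
  exact integral_finsetSum _ fun t _ => π.integrable_item_ite F ν T t i

lemma expPulls_nonneg (T n : ℕ) (i : Fin L) : 0 ≤ π.expPulls F ν T n i :=
  integral_nonneg fun _ => Nat.cast_nonneg _

lemma sum_expPulls (T n : ℕ) : ∑ i, π.expPulls F ν T n i = n := by
  simp_rw [expPulls]
  rw [← integral_finsetSum _ fun i _ => π.integrable_pulls F ν T n i]
  simp [sum_pulls]

lemma measurePreserving_reward (t : ℕ) (i : Fin L) :
    MeasurePreserving (fun ω : ℝ × (ℕ → Fin L → ℝ) => ω.2 t i) (π.law F ν) (F.dist (ν i)) := by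
  have := π.isProbability
  exact (measurePreserving_eval (fun i => F.dist (ν i)) i).comp
    ((measurePreserving_eval_infinitePi
      (fun _ : ℕ => Measure.pi fun i => F.dist (ν i)) t).comp measurePreserving_snd)

lemma integrable_item_mul_logRatio (T t : ℕ) (i : Fin L) :
    Integrable (fun ω => (if π.item T ω t = i then (1 : ℝ) else 0) *
      F.logRatio (ν i) (ν' i) (ω.2 t i)) (π.law F ν) := by
  have h : Integrable (fun ω : ℝ × (ℕ → Fin L → ℝ) => F.logRatio (ν i) (ν' i) (ω.2 t i))
      (π.law F ν) :=
    (π.measurePreserving_reward F ν t i).integrable_comp_of_integrable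
      (F.integrable_logRatio (ν i) (ν' i))
  refine h.bdd_mul (c := 1) (π.measurable_item_ite T t i).aestronglyMeasurable
    (Eventually.of_forall fun ω => ?_)
  split_ifs <;> simp

/-- The choice at time `t` is a function of the past, so after resampling the rewards at `t` the
integrand is a product of independent factors. This is Wald's identity, one step at a time. -/
lemma integral_item_mul_logRatio (T t : ℕ) (i : Fin L) :
    ∫ ω, (if π.item T ω t = i then (1 : ℝ) else 0) * F.logRatio (ν i) (ν' i) (ω.2 t i)
        ∂π.law F ν =
      (∫ ω, (if π.item T ω t = i then (1 : ℝ) else 0) ∂π.law F ν) * F.kl (ν i) (ν' i) := by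
  have hmp := π.measurePreserving_resample F ν t
  rw [← hmp.map_eq, integral_map hmp.measurable.aemeasurable]
  · have h (p : (ℝ × (ℕ → Fin L → ℝ)) × (Fin L → ℝ)) :
        (if π.item T (resample t p) t = i then (1 : ℝ) else 0) *
          F.logRatio (ν i) (ν' i) ((resample t p).2 t i) =
        (if π.item T p.1 t = i then (1 : ℝ) else 0) * F.logRatio (ν i) (ν' i) (p.2 i) := by
      rw [item_eq_pull, record_resample, item_eq_pull]
      simp [resample]
    simp_rw [h]
    rw [integral_prod_mul (fun ω => if π.item T ω t = i then (1 : ℝ) else 0)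
      (fun z : Fin L → ℝ => F.logRatio (ν i) (ν' i) (z i)), hmp.map_eq, ← F.integral_logRatio]
    congr 1
    have he := measurePreserving_eval (fun i => F.dist (ν i)) i
    conv_rhs => rw [← he.map_eq]
    rw [integral_map he.measurable.aemeasurable (by fun_prop)]
  · rw [hmp.map_eq]
    exact (π.integrable_item_mul_logRatio F ν ν' T t i).aestronglyMeasurable

lemma logLik_record (T n : ℕ) (ω : ℝ × (ℕ → Fin L → ℝ)) :
    logLik F ν ν' (π.record T n ω).2 = ∑ t ∈ Finset.range n, ∑ i,
      (if π.item T ω t = i then (1 : ℝ) else 0) * F.logRatio (ν i) (ν' i) (ω.2 t i) := by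
  rw [logLik, Finset.sum_range]
  simp [record_apply_fst]

lemma integrable_logLik (T n : ℕ) :
    Integrable (fun ω => logLik F ν ν' (π.record T n ω).2) (π.law F ν) := by
  simp_rw [logLik_record]
  exact integrable_finsetSum _ fun t _ => integrable_finsetSum _ fun i _ =>
    π.integrable_item_mul_logRatio F ν ν' T t i

/-- The divergence decomposition. -/
lemma integral_logLik (T n : ℕ) :
    ∫ ω, logLik F ν ν' (π.record T n ω).2 ∂π.law F ν =
      ∑ i, π.expPulls F ν T n i * F.kl (ν i) (ν' i) := by
  simp_rw [logLik_record]
  rw [integral_finsetSum _ fun t _ => integrable_finsetSum _ fun i _ =>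
    π.integrable_item_mul_logRatio F ν ν' T t i]
  have h (t : ℕ) := integral_finsetSum (μ := π.law F ν) Finset.univ fun i _ =>
    π.integrable_item_mul_logRatio F ν ν' T t i
  simp_rw [h, integral_item_mul_logRatio, expPulls_eq_sum, Finset.sum_mul]
  exact Finset.sum_comm

/-- A transportation inequality of Donsker-Varadhan type for an event observed by time `n`. -/
lemma mul_prob_le_sum_expPulls_mul_kl_add_log (T n : ℕ) {B : Set (ℝ × (Fin n → Fin L × ℝ))}
    (hB : MeasurableSet B) (c : ℝ) :
    c * (π.law F ν).real (π.record T n ⁻¹' B) ≤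
      (∑ i, π.expPulls F ν T n i * F.kl (ν i) (ν' i)) +
        Real.log (1 + Real.exp c * (π.law F ν').real (π.record T n ⁻¹' B)) := by
  set A := π.record T n ⁻¹' B
  have hA : MeasurableSet A := π.measurable_record T n hB
  set m := 1 + Real.exp c * (π.law F ν').real A with hm
  have hm0 : 0 < m := by positivity
  set b : ℝ × (Fin n → Fin L × ℝ) → ℝ := B.indicator fun _ => c
  have hb : Measurable b := measurable_const.indicator hB
  -- Since `exp (-logLik)` is the density of `ν'` with respect to `ν` on records, `exp g` integrates
  -- under `ν` to the `ν'`-mean of `exp b`, which is at most `m`.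
  set g : ℝ × (ℕ → Fin L → ℝ) → ℝ := fun ω =>
    b (π.record T n ω) - logLik F ν ν' (π.record T n ω).2
  have hgm : Measurable g := (hb.comp (π.measurable_record T n)).sub
    ((measurable_logLik F ν ν' n).comp (measurable_snd.comp (π.measurable_record T n)))
  have hbA : (fun ω => b (π.record T n ω)) = A.indicator fun _ => c := rfl
  have hbi : Integrable (fun ω => b (π.record T n ω)) (π.law F ν) := by
    rw [hbA]; exact (integrable_const c).indicator hA
  have hgi : Integrable g (π.law F ν) := hbi.sub (π.integrable_logLik F ν ν' T n)
  have hgint : ∫ ω, g ω ∂π.law F ν =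
      c * (π.law F ν).real A - ∑ i, π.expPulls F ν T n i * F.kl (ν i) (ν' i) := by
    rw [integral_sub hbi (π.integrable_logLik F ν ν' T n), integral_logLik, hbA,
      integral_indicator_const _ hA, smul_eq_mul, mul_comm]
  have hlin : ∫⁻ ω, ENNReal.ofReal (Real.exp (g ω)) ∂π.law F ν ≤ ENNReal.ofReal m := by
    calc ∫⁻ ω, ENNReal.ofReal (Real.exp (g ω)) ∂π.law F ν
        = ∫⁻ ω, ENNReal.ofReal (Real.exp (b (π.record T n ω))) ∂π.law F ν' := by
          rw [π.lintegral_record F ν ν' T n (f := fun r => ENNReal.ofReal (Real.exp (b r)))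
            (by fun_prop)]
          refine lintegral_congr fun ω => ?_
          rw [← ENNReal.ofReal_mul (Real.exp_pos _).le, ← Real.exp_add, ← sub_eq_add_neg]
      _ ≤ ∫⁻ ω, 1 + A.indicator (fun _ => ENNReal.ofReal (Real.exp c)) ω ∂π.law F ν' := by
          refine lintegral_mono fun ω => ?_
          by_cases hω : ω ∈ A
          · have : b (π.record T n ω) = c := Set.indicator_of_mem (s := B) hω _
            simp [hω, this]
          · have : b (π.record T n ω) = 0 := Set.indicator_of_notMem (s := B) hω _
            simp [hω, this]
      _ = ENNReal.ofReal m := by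
          rw [lintegral_add_left measurable_const, lintegral_indicator_const hA, lintegral_const,
            measure_univ, hm, ENNReal.ofReal_add zero_le_one (by positivity),
            ENNReal.ofReal_mul (Real.exp_pos c).le, measureReal_def,
            ENNReal.ofReal_toReal (measure_ne_top _ _)]
          simp
  have hei : Integrable (fun ω => Real.exp (g ω)) (π.law F ν) := by
    refine ⟨by fun_prop, ?_⟩
    rw [hasFiniteIntegral_iff_ofReal (Eventually.of_forall fun ω => (Real.exp_pos _).le)]
    exact hlin.trans_lt ENNReal.ofReal_lt_top
  have heint : ∫ ω, Real.exp (g ω) ∂π.law F ν ≤ m := by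
    rw [integral_eq_lintegral_of_nonneg_ae (Eventually.of_forall fun ω => (Real.exp_pos _).le)
      hei.aestronglyMeasurable]
    exact ENNReal.toReal_le_of_le_ofReal hm0.le hlin
  -- This is `log x ≤ x - 1` at `x = exp y / m`. Integrated at `y = g ω`, it gives `E g ≤ log m` and
  -- takes the place of Jensen's inequality.
  have hpt (y : ℝ) : y ≤ Real.exp y / m + (Real.log m - 1) := by
    have := Real.log_le_sub_one_of_pos (div_pos (Real.exp_pos y) hm0)
    rw [Real.log_div (Real.exp_pos y).ne' hm0.ne', Real.log_exp] at this
    linarith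
  have hle := integral_mono hgi ((hei.div_const m).add (integrable_const (Real.log m - 1)))
    fun ω => hpt (g ω)
  simp only [Pi.add_apply] at hle
  rw [integral_add (hei.div_const m) (integrable_const _), integral_div, hgint] at hle
  have h1 : (∫ ω, Real.exp (g ω) ∂π.law F ν) / m ≤ 1 := (div_le_one hm0).2 heint
  simp at hle
  linarith

end Law

end Policy

/-! ### Evaluating the oracle saved regret -/

section Oracle

variable {L : ℕ} (F : ExpFamily) (ν : Instance L)

lemma antitone_mean_sorted : Antitone fun k => F.mean (ν (sorted F ν k)) := fun _ _ h =>
  neg_le_neg_iff.1 (Tuple.monotone_sort (fun i => -F.mean (ν i)) h)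

lemma sum_sorted_filter {M : Type*} [AddCommMonoid M] (p : Fin L → Prop) [DecidablePred p]
    (f : Fin L → M) :
    ∑ k with p (sorted F ν k), f (sorted F ν k) = ∑ i with p i, f i := by
  rw [Finset.sum_filter, Finset.sum_filter]
  exact Equiv.sum_comp (sorted F ν) fun i => if p i then f i else 0

variable [NeZero L]

lemma mean_le_mean_best (i : Fin L) : F.mean (ν i) ≤ F.mean (ν (best F ν)) := by
  have := antitone_mean_sorted F ν (Fin.zero_le ((sorted F ν).symm i))
  simpa [best] using this

lemma gap_nonneg (i : Fin L) : 0 ≤ gap F ν i := sub_nonneg.2 (mean_le_mean_best F ν i)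

lemma monotone_gap_sorted : Monotone fun k => gap F ν (sorted F ν k) := fun _ _ h =>
  sub_le_sub_left (antitone_mean_sorted F ν h) _

variable {F ν}

/-- Which optimal item is selected depends on how sorting breaks ties; only its parameter is
determined, and gaps and divergences use nothing else. -/
lemma best_eq {v : ℝ} (hex : ∃ i, ν i = v) (hlt : ∀ i, ν i ≠ v → F.mean (ν i) < F.mean v) :
    ν (best F ν) = v := by
  by_contra h
  obtain ⟨i, rfl⟩ := hex
  exact absurd (mean_le_mean_best F ν i) (not_le.2 (hlt _ h))

lemma need_eq_ofReal {i : Fin L} (h : gap F ν i ≠ 0) (T : ℕ) :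
    need F ν T i = ENNReal.ofReal (Real.log T / F.kl (ν i) (ν (best F ν))) := by
  have hk : 0 < F.kl (ν i) (ν (best F ν)) := F.kl_pos fun h' => h (by rw [gap, h', sub_self])
  rw [need, ENNReal.ofReal_div_of_pos hk, F.ofReal_kl]

/-- Positivity of `log T` matters: in `ℝ≥0∞` a positive number divided by `0` is `∞`, but `0 / 0 =
0`. -/
lemma need_best {T : ℕ} (hT : 0 < Real.log T) : need F ν T (best F ν) = ∞ := by
  rw [need, InformationTheory.klDiv_self, ENNReal.div_zero (by simpa using hT)]

/-- If the worst items can absorb the whole budget, the oracle saves their gap at each step. -/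
lemma oracleSave_eq_mul {G : ℝ} (hG : ∀ i, gap F ν i ≤ G) (hex : ∃ i, gap F ν i = G)
    {T n : ℕ} (hn : (n : ℝ≥0∞) ≤ ∑ i with gap F ν i = G, need F ν T i) :
    oracleSave F ν T n = G * n := by
  have hmono := monotone_gap_sorted F ν
  obtain ⟨i₀, hi₀⟩ := hex
  -- In sorted order the items of maximal gap form a final segment. The position `iFE` lies in it,
  -- so every gap in the oracle formula is `G` and the needs cancel.
  set J : Finset (Fin L) := Finset.univ.filter fun k => gap F ν (sorted F ν k) = G with hJ
  have hJne : J.Nonempty := ⟨(sorted F ν).symm i₀, by simp [hJ, hi₀]⟩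
  have hmem (k : Fin L) (hk : J.min' hJne ≤ k) : gap F ν (sorted F ν k) = G := by
    refine (hG _).antisymm ?_
    have h1 := (Finset.mem_filter.1 (J.min'_mem hJne)).2
    exact h1.symm.le.trans (hmono hk)
  have hIci : Finset.Ici (J.min' hJne) = J := by
    ext k
    rw [Finset.mem_Ici]
    exact ⟨fun h => Finset.mem_filter.2 ⟨Finset.mem_univ _, hmem k h⟩, fun h => J.min'_le k h⟩
  have hle : J.min' hJne ≤ iFE F ν T n := by
    refine Finset.le_sup (f := id) (Finset.mem_filter.2 ⟨Finset.mem_univ _, ?_⟩)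
    change (n : ℝ≥0∞) ≤ ∑ k ∈ Finset.Ici (J.min' hJne), need F ν T (sorted F ν k)
    rw [hIci, hJ, sum_sorted_filter F ν (fun i => gap F ν i = G)]
    exact hn
  have hsum : ∑ k ∈ Finset.Ioi (iFE F ν T n),
      gap F ν (sorted F ν k) * (need F ν T (sorted F ν k)).toReal =
      G * ∑ k ∈ Finset.Ioi (iFE F ν T n), (need F ν T (sorted F ν k)).toReal := by
    rw [Finset.mul_sum]
    refine Finset.sum_congr rfl fun k hk => ?_
    rw [hmem k (hle.trans (Finset.mem_Ioi.1 hk).le)]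
  rw [oracleSave, hsum, hmem _ hle]
  ring

/-- If the suboptimal items all have the same gap and cannot absorb the whole budget, the oracle
saves everything there is to save. -/
lemma oracleSave_eq_sum {G : ℝ} (hG : ∀ i, gap F ν i = 0 ∨ gap F ν i = G) (hG0 : 0 < G)
    {T n : ℕ} (hT : 0 < Real.log T) (hn : ∑ i with gap F ν i = G, need F ν T i < n) :
    oracleSave F ν T n = ∑ i, gap F ν i * (need F ν T i).toReal := by
  classical
  have hmono := monotone_gap_sorted F ν
  set S : Finset (Fin L) := Finset.univ.filter fun j : Fin L =>
    (n : ℝ≥0∞) ≤ ∑ k ∈ Finset.Ici j, need F ν T (sorted F ν k) with hS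
  have hiFE : iFE F ν T n = S.sup id := by
    rw [iFE, hS]
  have hSne : S.Nonempty := by
    -- Position `0` holds an optimal item, which absorbs any budget. Nonemptiness ensures that the
    -- supremum defining `iFE` is attained rather than a default value.
    refine ⟨0, Finset.mem_filter.2 ⟨Finset.mem_univ _, ?_⟩⟩
    refine le_trans ?_ (Finset.single_le_sum (f := fun k => need F ν T (sorted F ν k))
      (fun _ _ => zero_le) (Finset.mem_Ici.2 le_rfl))
    have : need F ν T (sorted F ν 0) = ∞ := need_best hT
    simp [this]
  obtain ⟨m, hm, hmS⟩ := S.exists_mem_eq_sup hSne id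
  rw [← hiFE, id] at hmS
  -- A positive gap at `m` would make all items from `m` on suboptimal, and these cannot absorb `n`.
  -- Hence the leading term of the oracle vanishes.
  have hgm : gap F ν (sorted F ν m) = 0 := by
    refine (hG _).resolve_right fun h => ?_
    refine absurd (Finset.mem_filter.1 hm).2 (not_le.2 (lt_of_le_of_lt ?_ hn))
    rw [← sum_sorted_filter F ν (fun i => gap F ν i = G)]
    refine Finset.sum_le_sum_of_subset fun k hk => ?_
    refine Finset.mem_filter.2 ⟨Finset.mem_univ _, (hG _).resolve_left fun h0 => ?_⟩
    have := hmono (Finset.mem_Ici.1 hk)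
    simp only [h, h0] at this
    linarith
  rw [oracleSave, hmS, hgm, zero_mul, zero_add,
    ← Equiv.sum_comp (sorted F ν) fun i => gap F ν i * (need F ν T i).toReal]
  refine Finset.sum_subset (Finset.subset_univ _) fun k _ hk => ?_
  have hkm : k ≤ m := not_lt.1 fun h => hk (Finset.mem_Ioi.2 h)
  have h0 : gap F ν (sorted F ν k) = 0 :=
    le_antisymm ((hmono hkm).trans_eq hgm) (gap_nonneg F ν _)
  rw [h0, zero_mul]

lemma savedBy_le_sum (T : ℕ) (N : Fin L → ℝ) (hN : ∀ i, 0 ≤ N i) :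
    savedBy F ν T N ≤ ∑ i, gap F ν i * N i := by
  unfold savedBy
  refine (Finset.sum_le_sum fun i _ => mul_le_mul_of_nonneg_left (min_le_left _ _)
    (gap_nonneg F ν i)).trans ?_
  exact Finset.sum_le_sum_of_subset_of_nonneg (Finset.filter_subset _ _)
    fun i _ _ => mul_nonneg (gap_nonneg F ν i) (hN i)

end Oracle

/-! ### Instances with two values; `W` is the set of worse items -/

section TwoValues

variable {L : ℕ} [NeZero L] {F : ExpFamily} {ν : Instance L} {W : Finset (Fin L)} {v w : ℝ}

lemma best_eq_of_two (hW : ∀ i ∈ W, ν i = w) (hV : ∀ i ∉ W, ν i = v) (hex : ∃ i, i ∉ W)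
    (hlt : F.mean w < F.mean v) : ν (best F ν) = v := by
  obtain ⟨i, hi⟩ := hex
  refine best_eq ⟨i, hV i hi⟩ fun j hj => ?_
  rw [hW j (by_contra fun h => hj (hV j h))]
  exact hlt

lemma gap_of_mem (hW : ∀ i ∈ W, ν i = w) (hV : ∀ i ∉ W, ν i = v) (hex : ∃ i, i ∉ W)
    (hlt : F.mean w < F.mean v) {i : Fin L} (hi : i ∈ W) :
    gap F ν i = F.mean v - F.mean w := by
  rw [gap, best_eq_of_two hW hV hex hlt, hW i hi]

lemma gap_of_notMem (hW : ∀ i ∈ W, ν i = w) (hV : ∀ i ∉ W, ν i = v) (hex : ∃ i, i ∉ W)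
    (hlt : F.mean w < F.mean v) {i : Fin L} (hi : i ∉ W) : gap F ν i = 0 := by
  rw [gap, best_eq_of_two hW hV hex hlt, hV i hi, sub_self]

lemma filter_gap_eq (hW : ∀ i ∈ W, ν i = w) (hV : ∀ i ∉ W, ν i = v) (hex : ∃ i, i ∉ W)
    (hlt : F.mean w < F.mean v) :
    (Finset.univ.filter fun i => gap F ν i = F.mean v - F.mean w) = W := by
  ext i
  simp only [Finset.mem_filter, Finset.mem_univ, true_and]
  refine ⟨fun h => by_contra fun hi => ?_, fun hi => gap_of_mem hW hV hex hlt hi⟩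
  rw [gap_of_notMem hW hV hex hlt hi] at h
  linarith

lemma savedBy_of_two (hW : ∀ i ∈ W, ν i = w) (hV : ∀ i ∉ W, ν i = v) (hex : ∃ i, i ∉ W)
    (hlt : F.mean w < F.mean v) (T : ℕ) (N : Fin L → ℝ) :
    savedBy F ν T N =
      (F.mean v - F.mean w) * ∑ i ∈ W, min (N i) (Real.log T / F.kl w v) := by
  have hfil : (Finset.univ.filter fun i => 0 < gap F ν i) = W := by
    ext i
    simp only [Finset.mem_filter, Finset.mem_univ, true_and]
    refine ⟨fun h => by_contra fun hi => ?_, fun hi => ?_⟩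
    · rw [gap_of_notMem hW hV hex hlt hi] at h
      exact h.false
    · rw [gap_of_mem hW hV hex hlt hi]
      linarith
  have hs : savedBy F ν T N = ∑ i ∈ W, gap F ν i *
      min (N i) (Real.log T / F.kl (ν i) (ν (best F ν))) := by
    rw [← hfil, savedBy]
  rw [hs, Finset.mul_sum]
  refine Finset.sum_congr rfl fun i hi => ?_
  rw [gap_of_mem hW hV hex hlt hi, hW i hi, best_eq_of_two hW hV hex hlt]

lemma oracleSave_of_two (hW : ∀ i ∈ W, ν i = w) (hV : ∀ i ∉ W, ν i = v) (hex : ∃ i, i ∉ W)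
    (hlt : F.mean w < F.mean v) (hWne : W.Nonempty) {T : ℕ} (hT : 0 < Real.log T) (n : ℕ) :
    oracleSave F ν T n =
      (F.mean v - F.mean w) * min (n : ℝ) (W.card * Real.log T / F.kl w v) := by
  have hk : 0 < F.kl w v := F.kl_pos hlt.ne
  have hneed (i : Fin L) (hi : i ∈ W) :
      need F ν T i = ENNReal.ofReal (Real.log T / F.kl w v) := by
    rw [need_eq_ofReal, hW i hi, best_eq_of_two hW hV hex hlt]
    rw [gap_of_mem hW hV hex hlt hi]
    linarith
  have hsum : ∑ i with gap F ν i = F.mean v - F.mean w, need F ν T i =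
      ENNReal.ofReal (W.card * Real.log T / F.kl w v) := by
    rw [filter_gap_eq hW hV hex hlt, Finset.sum_congr rfl hneed, Finset.sum_const, nsmul_eq_mul,
      mul_div_assoc, ENNReal.ofReal_mul (Nat.cast_nonneg _), ENNReal.ofReal_natCast]
  have hcases (i : Fin L) : gap F ν i = 0 ∨ gap F ν i = F.mean v - F.mean w := by
    by_cases hi : i ∈ W
    · exact Or.inr (gap_of_mem hW hV hex hlt hi)
    · exact Or.inl (gap_of_notMem hW hV hex hlt hi)
  rcases le_or_gt (n : ℝ) (W.card * Real.log T / F.kl w v) with h | h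
  · rw [min_eq_left h]
    refine oracleSave_eq_mul (fun i => ?_) ?_ ?_
    · rcases hcases i with h | h <;> rw [h]
      linarith
    · obtain ⟨i, hi⟩ := hWne
      exact ⟨i, gap_of_mem hW hV hex hlt hi⟩
    · rw [hsum, ← ENNReal.ofReal_natCast]
      exact ENNReal.ofReal_le_ofReal h
  · rw [min_eq_right h.le, oracleSave_eq_sum hcases (sub_pos.2 hlt) hT]
    · rw [← Finset.sum_subset (Finset.subset_univ W)]
      · rw [Finset.sum_congr rfl fun i hi => by
          rw [hneed i hi, gap_of_mem hW hV hex hlt hi, ENNReal.toReal_ofReal (by positivity)],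
          Finset.sum_const, nsmul_eq_mul]
        ring
      · intro i _ hi
        rw [gap_of_notMem hW hV hex hlt hi, zero_mul]
    · rw [hsum, ← ENNReal.ofReal_natCast]
      exact (ENNReal.ofReal_lt_ofReal_iff (lt_of_le_of_lt (by positivity) h)).2 h

/-- Saving on an instance with two values means exploring the worse items. -/
lemma mul_min_le_of_saving (hW : ∀ i ∈ W, ν i = w) (hV : ∀ i ∉ W, ν i = v) (hex : ∃ i, i ∉ W)
    (hlt : F.mean w < F.mean v) (hWne : W.Nonempty) {T n : ℕ} (hT : 0 < Real.log T) {α : ℝ}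
    {N : Fin L → ℝ} (h : α * oracleSave F ν T n ≤ savedBy F ν T N) :
    α * min (n : ℝ) (W.card * Real.log T / F.kl w v) ≤ ∑ i ∈ W, N i := by
  rw [oracleSave_of_two hW hV hex hlt hWne hT, savedBy_of_two hW hV hex hlt] at h
  have hG := sub_pos.2 hlt
  have h' : α * min (n : ℝ) (W.card * Real.log T / F.kl w v) ≤
      ∑ i ∈ W, min (N i) (Real.log T / F.kl w v) := by
    refine le_of_mul_le_mul_left ?_ hG
    linarith
  exact h'.trans (Finset.sum_le_sum fun i _ => min_le_left _ _)

end TwoValues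

/-! ### Instances with three values; `W` is the worst group, `M` the middle one -/

section ThreeValues

variable {L : ℕ} [NeZero L] {F : ExpFamily} {ν : Instance L} {W M : Finset (Fin L)} {u v w : ℝ}

/-- Saving on an instance with three values whose worst items can absorb the budget. -/
lemma mul_le_of_saving_of_three (hW : ∀ i ∈ W, ν i = w) (hM : ∀ i ∈ M, ν i = u)
    (hV : ∀ i, i ∉ W → i ∉ M → ν i = v) (hex : ∃ i, i ∉ W ∧ i ∉ M) (hWM : Disjoint W M)
    (huv : F.mean u < F.mean v) (hwu : F.mean w < F.mean u) (hWne : W.Nonempty)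
    {T n : ℕ} (hn : (n : ℝ) ≤ W.card * Real.log T / F.kl w v) {α : ℝ} {N : Fin L → ℝ}
    (hN : ∀ i, 0 ≤ N i) (h : α * oracleSave F ν T n ≤ savedBy F ν T N) :
    α * ((F.mean v - F.mean w) * n) ≤
      (F.mean v - F.mean w) * ∑ i ∈ W, N i + (F.mean v - F.mean u) * ∑ i ∈ M, N i := by
  have hbest : ν (best F ν) = v := by
    obtain ⟨i, hi, hi'⟩ := hex
    refine best_eq ⟨i, hV i hi hi'⟩ fun j hj => ?_
    by_cases h1 : j ∈ W
    · rw [hW j h1]; exact hwu.trans huv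
    by_cases h2 : j ∈ M
    · rw [hM j h2]; exact huv
    exact absurd (hV j h1 h2) hj
  have hgW (i : Fin L) (hi : i ∈ W) : gap F ν i = F.mean v - F.mean w := by
    rw [gap, hbest, hW i hi]
  have hgM (i : Fin L) (hi : i ∈ M) : gap F ν i = F.mean v - F.mean u := by
    rw [gap, hbest, hM i hi]
  have hgV (i : Fin L) (hi : i ∉ W) (hi' : i ∉ M) : gap F ν i = 0 := by
    rw [gap, hbest, hV i hi hi', sub_self]
  have hfil : (Finset.univ.filter fun i => gap F ν i = F.mean v - F.mean w) = W := by
    ext i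
    simp only [Finset.mem_filter, Finset.mem_univ, true_and]
    refine ⟨fun h => by_contra fun hi => ?_, hgW i⟩
    by_cases h2 : i ∈ M
    · rw [hgM i h2] at h; linarith
    · rw [hgV i hi h2] at h; linarith
  have horacle : oracleSave F ν T n = (F.mean v - F.mean w) * n := by
    refine oracleSave_eq_mul (fun i => ?_) ?_ ?_
    · by_cases h1 : i ∈ W
      · rw [hgW i h1]
      by_cases h2 : i ∈ M
      · rw [hgM i h2]; linarith
      · rw [hgV i h1 h2]; linarith
    · obtain ⟨i, hi⟩ := hWne
      exact ⟨i, hgW i hi⟩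
    · rw [hfil, Finset.sum_congr rfl (g := fun _ => ENNReal.ofReal (Real.log T / F.kl w v)),
        Finset.sum_const, nsmul_eq_mul, ← ENNReal.ofReal_natCast, ← ENNReal.ofReal_natCast,
        ← ENNReal.ofReal_mul (Nat.cast_nonneg _), ← mul_div_assoc]
      · exact ENNReal.ofReal_le_ofReal hn
      · intro i hi
        rw [need_eq_ofReal, hbest, hW i hi]
        rw [hgW i hi]; linarith
  rw [← horacle]
  -- The truncations may be dropped, since only an upper bound on the savings is needed.
  refine h.trans ((savedBy_le_sum T N hN).trans_eq ?_)
  rw [← Finset.sum_subset (Finset.subset_univ (W ∪ M)), Finset.sum_union hWM, Finset.mul_sum,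
    Finset.mul_sum]
  · congr 1
    · exact Finset.sum_congr rfl fun i hi => by rw [hgW i hi]
    · exact Finset.sum_congr rfl fun i hi => by rw [hgM i hi]
  · intro i _ hi
    rw [Finset.mem_union, not_or] at hi
    rw [hgV i hi.1 hi.2, zero_mul]

end ThreeValues

/-! ### From incompatible savings to information and regret bounds -/

section Asymptotics

variable {L : ℕ} [NeZero L] (F : ExpFamily) (ν ν' : Instance L) (π : Policy L)

/-- The pull counts up to time `n` are read off the record, so saving is an event to which the
change of measure at time `n` applies. -/
lemma exists_saving_eq_preimage (x : ℝ) (T n : ℕ) :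
    ∃ B : Set (ℝ × (Fin n → Fin L × ℝ)), MeasurableSet B ∧
      {ω | x ≤ empSave F ν π T n ω} = π.record T n ⁻¹' B := by
  classical
  refine ⟨{r | x ≤ savedBy F ν T fun i =>
    ∑ s, if (r.2 s).1 = i then (1 : ℝ) else 0}, ?_, ?_⟩
  · refine measurableSet_le measurable_const ?_
    unfold savedBy
    refine Finset.measurable_sum _ fun i _ => Measurable.const_mul (Measurable.min ?_
      measurable_const) _
    refine Finset.measurable_sum _ fun s _ => Measurable.ite ?_ measurable_const measurable_const
    have : Measurable fun r : ℝ × (Fin n → Fin L × ℝ) => (r.2 s).1 := by fun_prop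
    exact this (measurableSet_singleton i)
  · ext ω
    simp only [Set.mem_ofPred_eq, Set.mem_preimage, empSave, Policy.pulls_eq_of_record]
    simp

variable {F ν ν' π}

/-- If a policy saves on two instances which cannot be saved on simultaneously, it has to collect
`β * log T` of information to tell them apart. -/
lemma eventually_le_sum_expPulls_mul_kl {α β : ℝ} (hβ : 0 < β) {TFE : ℕ → ℕ}
    (h : ProbablySaving F ν α β TFE π) (h' : ProbablySaving F ν' α β TFE π)
    (hdisj : ∀ᶠ T : ℕ in atTop, ∀ ω,
      α * oracleSave F ν T (TFE T) ≤ empSave F ν π T (TFE T) ω →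
      ¬ α * oracleSave F ν' T (TFE T) ≤ empSave F ν' π T (TFE T) ω)
    {ε : ℝ} (hε : 0 < ε) :
    ∀ᶠ T : ℕ in atTop, (β - ε) * Real.log T ≤
      ∑ i, π.expPulls F ν T (TFE T) i * F.kl (ν i) (ν' i) := by
  obtain ⟨C, hC⟩ := h
  obtain ⟨C', hC'⟩ := h'
  have hlog : Tendsto (fun T : ℕ => Real.log T) atTop atTop :=
    Real.tendsto_log_atTop.comp tendsto_natCast_atTop_atTop
  have hpow : Tendsto (fun T : ℕ => β * (|C| * (T : ℝ) ^ (-β))) atTop (𝓝 0) := by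
    have := (tendsto_rpow_neg_atTop hβ).comp (tendsto_natCast_atTop_atTop (R := ℝ))
    simpa using (this.const_mul |C|).const_mul β
  -- One half of `ε` pays for the failure probability under `ν`, the other for the constant `log (1
  -- + |C'|)`.
  filter_upwards [hC, hC', hdisj, hpow.eventually_lt_const (half_pos hε),
    hlog.eventually_ge_atTop (2 / ε * Real.log (1 + |C'|)), hlog.eventually_gt_atTop 0,
    eventually_gt_atTop 0] with T hP hP' hd hp hl hl0 hT
  have hT' : (0 : ℝ) < T := Nat.cast_pos.2 hT
  obtain ⟨B, hB, hBeq⟩ := exists_saving_eq_preimage F ν π (α * oracleSave F ν T (TFE T)) T (TFE T)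
  obtain ⟨B', hB', hBeq'⟩ :=
    exists_saving_eq_preimage F ν' π (α * oracleSave F ν' T (TFE T)) T (TFE T)
  have hsub : π.record T (TFE T) ⁻¹' B ⊆ (π.record T (TFE T) ⁻¹' B')ᶜ := by
    rw [← hBeq, ← hBeq']
    exact fun ω hω => hd ω hω
  rw [hBeq] at hP
  rw [hBeq'] at hP'
  have hle' : (π.law F ν').real (π.record T (TFE T) ⁻¹' B) ≤ |C'| * (T : ℝ) ^ (-β) := by
    refine (measureReal_mono hsub).trans ?_
    rw [probReal_compl_eq_one_sub (π.measurable_record T _ hB')]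
    have := mul_le_mul_of_nonneg_right (le_abs_self C') (Real.rpow_nonneg hT'.le (-β))
    linarith
  have hle : 1 - |C| * (T : ℝ) ^ (-β) ≤ (π.law F ν).real (π.record T (TFE T) ⁻¹' B) := by
    have := mul_le_mul_of_nonneg_right (le_abs_self C) (Real.rpow_nonneg hT'.le (-β))
    linarith
  -- With `c = β * log T` the factor `exp c = T ^ β` exactly offsets the probability `O(T ^ (-β))`
  -- under `ν'`, so the logarithmic term stays bounded.
  have key := π.mul_prob_le_sum_expPulls_mul_kl_add_log F ν ν' T (TFE T) hB (β * Real.log T)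
  have hexp : Real.exp (β * Real.log T) * (π.law F ν').real (π.record T (TFE T) ⁻¹' B) ≤ |C'| := by
    rw [mul_comm β, ← Real.rpow_def_of_pos hT']
    calc (T : ℝ) ^ β * (π.law F ν').real (π.record T (TFE T) ⁻¹' B)
        ≤ (T : ℝ) ^ β * (|C'| * (T : ℝ) ^ (-β)) :=
          mul_le_mul_of_nonneg_left hle' (Real.rpow_nonneg hT'.le _)
      _ = |C'| := by
          rw [Real.rpow_neg hT'.le]
          field_simp
  have hlog1 : Real.log (1 + Real.exp (β * Real.log T) *
      (π.law F ν').real (π.record T (TFE T) ⁻¹' B)) ≤ Real.log (1 + |C'|) :=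
    Real.log_le_log (by positivity) (by linarith)
  have h1 := mul_le_mul_of_nonneg_left hle (mul_nonneg hβ.le hl0.le)
  have h2 : Real.log (1 + |C'|) ≤ ε / 2 * Real.log T := by
    have := mul_le_mul_of_nonneg_left hl (half_pos hε).le
    rwa [← mul_assoc, show ε / 2 * (2 / ε) = 1 by field_simp, one_mul] at this
  have h3 := mul_le_mul_of_nonneg_right hp.le hl0.le
  nlinarith

variable {W : Finset (Fin L)} {v w : ℝ}

lemma limsupSave_le_of_eventually {TFE : ℕ → ℕ} {x : ℝ} {f : ℕ → ℝ} (hf : Tendsto f atTop (𝓝 x))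
    (hW : ∀ i ∈ W, ν i = w) (hV : ∀ i ∉ W, ν i = v) (hex : ∃ i, i ∉ W)
    (hlt : F.mean w < F.mean v)
    (h : ∀ᶠ T : ℕ in atTop, (∑ i ∈ W, min (π.expPulls F ν T (TFE T) i)
      (Real.log T / F.kl w v)) / Real.log T ≤ f T) :
    limsupSave F ν TFE π ≤ (F.mean v - F.mean w) * x := by
  have hG : 0 ≤ F.mean v - F.mean w := (sub_pos.2 hlt).le
  have hlim := hf.const_mul (F.mean v - F.mean w)
  rw [← hlim.limsup_eq, limsupSave]
  refine limsup_le_limsup ?_ ?_ hlim.isBoundedUnder_le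
  · filter_upwards [h] with T hT
    rw [meanSave, savedBy_of_two hW hV hex hlt, mul_div_assoc]
    exact mul_le_mul_of_nonneg_left hT hG
  -- Comparing real limsups needs a lower bound on the smaller sequence; savings are nonnegative.
  · refine IsBoundedUnder.isCoboundedUnder_le ⟨0, eventually_map.2 (Eventually.of_forall fun T => ?_)⟩
    have hlog : 0 ≤ Real.log T := Real.log_natCast_nonneg T
    rw [meanSave, savedBy_of_two hW hV hex hlt]
    exact div_nonneg (mul_nonneg hG (Finset.sum_nonneg fun i _ => le_min
      (π.expPulls_nonneg F ν T _ i) (div_nonneg hlog (F.kl_nonneg _ _)))) hlog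

/-- Pulls outside `W` save nothing, and all pulls add up to the budget, so at least `ρ * log T` of
it is lost up to `ε`. -/
lemma limsupSave_le_of_forall {TFE : ℕ → ℕ} {g ρ : ℝ}
    (hTFE : Tendsto (fun T : ℕ => (TFE T : ℝ) / Real.log T) atTop (𝓝 g))
    (hW : ∀ i ∈ W, ν i = w) (hV : ∀ i ∉ W, ν i = v) (hex : ∃ i, i ∉ W)
    (hlt : F.mean w < F.mean v)
    (h : ∀ ε > 0, ∀ᶠ T : ℕ in atTop,
      (ρ - ε) * Real.log T ≤ ∑ i ∈ Wᶜ, π.expPulls F ν T (TFE T) i) :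
    limsupSave F ν TFE π ≤ (F.mean v - F.mean w) * (g - ρ) := by
  have hG : 0 < F.mean v - F.mean w := sub_pos.2 hlt
  have hlog : Tendsto (fun T : ℕ => Real.log T) atTop atTop :=
    Real.tendsto_log_atTop.comp tendsto_natCast_atTop_atTop
  refine le_of_forall_pos_le_add fun δ hδ => ?_
  have hε := div_pos hδ hG
  refine (limsupSave_le_of_eventually (hTFE.sub_const (ρ - δ / (F.mean v - F.mean w)))
    hW hV hex hlt ?_).trans_eq ?_
  · filter_upwards [h _ hε, hlog.eventually_gt_atTop 0] with T hT hl0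
    rw [div_le_iff₀ hl0, sub_mul, div_mul_cancel₀ _ hl0.ne']
    have h1 := Finset.sum_le_sum fun i (_ : i ∈ W) =>
      min_le_left (π.expPulls F ν T (TFE T) i) (Real.log T / F.kl w v)
    have h2 := Finset.sum_add_sum_compl W fun i => π.expPulls F ν T (TFE T) i
    rw [π.sum_expPulls] at h2
    linarith
  · field_simp
    ring

lemma limsupSave_le_card {TFE : ℕ → ℕ}
    (hW : ∀ i ∈ W, ν i = w) (hV : ∀ i ∉ W, ν i = v) (hex : ∃ i, i ∉ W)
    (hlt : F.mean w < F.mean v) :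
    limsupSave F ν TFE π ≤ (F.mean v - F.mean w) * (W.card / F.kl w v) := by
  have hlog : Tendsto (fun T : ℕ => Real.log T) atTop atTop :=
    Real.tendsto_log_atTop.comp tendsto_natCast_atTop_atTop
  refine limsupSave_le_of_eventually tendsto_const_nhds hW hV hex hlt ?_
  filter_upwards [hlog.eventually_gt_atTop 0] with T hl0
  rw [div_le_iff₀ hl0]
  refine (Finset.sum_le_sum fun i _ => min_le_right _ _).trans_eq ?_
  rw [Finset.sum_const, nsmul_eq_mul]
  ring

end Asymptotics

/-! ### Incompatibility of saving on the base and the alternative instances -/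

section Alternatives

variable {L : ℕ} [NeZero L] {F : ExpFamily} {ν ν' : Instance L} {π : Policy L}
  {B : Finset (Fin L)} {a b : ℝ} {TFE : ℕ → ℕ} {g α β : ℝ}

lemma tendsto_log_natCast : Tendsto (fun T : ℕ => Real.log T) atTop atTop :=
  Real.tendsto_log_atTop.comp tendsto_natCast_atTop_atTop

/-- A strict inequality between the normalized limits persists for large `T`; multiplying by `log T`
turns it into one between pull counts. -/
lemma eventually_mul_lt_mul_min {c κ : ℝ}
    (hTFE : Tendsto (fun T : ℕ => (TFE T : ℝ) / Real.log T) atTop (𝓝 g))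
    (hc : c * g < α * min g κ) :
    ∀ᶠ T : ℕ in atTop, c * TFE T < α * min (TFE T : ℝ) (κ * Real.log T) := by
  have h1 := (hTFE.const_mul c).eventually_lt ((hTFE.min tendsto_const_nhds).const_mul α) hc
  filter_upwards [h1, tendsto_log_natCast.eventually_gt_atTop 0] with T hT hl0
  have h2 := mul_lt_mul_of_pos_right hT hl0
  rwa [mul_assoc, div_mul_cancel₀ _ hl0.ne', mul_assoc, min_mul_of_nonneg _ _ hl0.le,
    div_mul_cancel₀ _ hl0.ne'] at h2

lemma pulls_saving_le (hb : ∀ i ∈ B, ν i = b) (ha : ∀ i ∉ B, ν i = a) (hex : ∃ i, i ∉ B)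
    (hab : F.mean b < F.mean a) (hBne : B.Nonempty) {T n : ℕ} (hT : 0 < Real.log T)
    {ω : ℝ × (ℕ → Fin L → ℝ)} (h : α * oracleSave F ν T n ≤ empSave F ν π T n ω) :
    α * min (n : ℝ) (B.card / F.kl b a * Real.log T) ≤ ∑ i ∈ B, (π.pulls T n i ω : ℝ) := by
  have := mul_min_le_of_saving hb ha hex hab hBne hT h
  rwa [mul_div_right_comm] at this

/-- Saving on a two-valued instance is incompatible with saving on an instance where the order
of the two groups of items is reversed. -/
lemma eventually_not_saving_of_reversed {a' b' : ℝ}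
    (hb : ∀ i ∈ B, ν i = b) (ha : ∀ i ∉ B, ν i = a) (hex : ∃ i, i ∉ B)
    (hab : F.mean b < F.mean a) (hBne : B.Nonempty)
    (hb' : ∀ i ∈ B, ν' i = b') (ha' : ∀ i ∉ B, ν' i = a') (hab' : F.mean a' < F.mean b')
    (hTFE : Tendsto (fun T : ℕ => (TFE T : ℝ) / Real.log T) atTop (𝓝 g))
    (hg : (1 - α) * g < α * min g (B.card / F.kl b a))
    (hn : ∀ᶠ T : ℕ in atTop, (TFE T : ℝ) ≤ (Bᶜ.card : ℝ) * Real.log T / F.kl a' b') :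
    ∀ᶠ T : ℕ in atTop, ∀ ω,
      α * oracleSave F ν T (TFE T) ≤ empSave F ν π T (TFE T) ω →
      ¬ α * oracleSave F ν' T (TFE T) ≤ empSave F ν' π T (TFE T) ω := by
  filter_upwards [eventually_mul_lt_mul_min hTFE hg, hn,
    tendsto_log_natCast.eventually_gt_atTop 0] with T hT hnT hl0 ω h h'
  have h1 := pulls_saving_le hb ha hex hab hBne hl0 h
  obtain ⟨i, hi⟩ := hex
  obtain ⟨j, hj⟩ := hBne
  have h2 := mul_min_le_of_saving (W := Bᶜ) (fun i hi => ha' i (Finset.mem_compl.1 hi))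
    (fun i hi => hb' i (by simpa using hi)) ⟨j, by simpa using hj⟩ hab'
    ⟨i, Finset.mem_compl.2 hi⟩ hl0 h'
  rw [min_eq_left hnT] at h2
  -- More than `(1 - α) * n` pulls in `B` and at least `α * n` outside `B` exceed the total `n`.
  have h3 := Finset.sum_add_sum_compl B fun i => (π.pulls T (TFE T) i ω : ℝ)
  rw [π.sum_pulls] at h3
  linarith

/-- Saving on a two-valued instance is incompatible with saving on an instance where some of the
good items are much worse than the bad ones. -/
lemma eventually_not_saving_of_three {W : Finset (Fin L)} {c : ℝ}
    (hb : ∀ i ∈ B, ν i = b) (ha : ∀ i ∉ B, ν i = a) (hab : F.mean b < F.mean a)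
    (hBne : B.Nonempty) (hc' : ∀ i ∈ W, ν' i = c) (hb' : ∀ i ∈ B, ν' i = b)
    (ha' : ∀ i, i ∉ W → i ∉ B → ν' i = a) (hex : ∃ i, i ∉ W ∧ i ∉ B) (hWB : Disjoint W B)
    (hWne : W.Nonempty) (hα : 1 / 2 < α)
    (hc : (1 - α) / (2 * α - 1) * (F.mean a - F.mean b) < F.mean b - F.mean c)
    (hcb : F.mean c < F.mean b) (hg0 : 0 < g)
    (hTFE : Tendsto (fun T : ℕ => (TFE T : ℝ) / Real.log T) atTop (𝓝 g))
    (hg : g ≤ B.card / F.kl b a)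
    (hn : ∀ᶠ T : ℕ in atTop, (TFE T : ℝ) ≤ (W.card : ℝ) * Real.log T / F.kl c a) :
    ∀ᶠ T : ℕ in atTop, ∀ ω,
      α * oracleSave F ν T (TFE T) ≤ empSave F ν π T (TFE T) ω →
      ¬ α * oracleSave F ν' T (TFE T) ≤ empSave F ν' π T (TFE T) ω := by
  have hξ : 0 < F.mean b - F.mean c := sub_pos.2 hcb
  have h2α : 0 < 2 * α - 1 := by linarith
  rw [div_mul_eq_mul_div, div_lt_iff₀ h2α] at hc
  -- The constant is the largest fraction of the budget that may go to `B` while saving on `ν'`: it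
  -- comes from `N_W ≤ n - N_B` in the saving inequality. The bound `hc` says exactly that it is
  -- below `α`.
  have hlt : (F.mean a - F.mean c) * (1 - α) / (F.mean b - F.mean c) * g <
      α * min g (B.card / F.kl b a) := by
    rw [min_eq_left hg]
    refine mul_lt_mul_of_pos_right ((div_lt_iff₀ hξ).2 ?_) hg0
    linarith
  filter_upwards [eventually_mul_lt_mul_min hTFE hlt, hn,
    tendsto_log_natCast.eventually_gt_atTop 0] with T hT hnT hl0 ω h h'
  have h1 := pulls_saving_le hb ha (hex.imp fun _ h => h.2) hab hBne hl0 h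
  have h2 := mul_le_of_saving_of_three hc' hb' ha' hex hWB hab hcb hWne hnT
    (fun i => Nat.cast_nonneg _) h'
  have h3 : ∑ i ∈ W, (π.pulls T (TFE T) i ω : ℝ) + ∑ i ∈ B, (π.pulls T (TFE T) i ω : ℝ) ≤
      TFE T := by
    rw [← Finset.sum_union hWB, ← π.sum_pulls T (TFE T) ω]
    exact Finset.sum_le_sum_of_subset_of_nonneg (Finset.subset_univ _)
      fun _ _ _ => Nat.cast_nonneg _
  have h4 := mul_lt_mul_of_pos_left (hT.trans_le h1) hξ
  have h5 : (F.mean b - F.mean c) *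
      ((F.mean a - F.mean c) * (1 - α) / (F.mean b - F.mean c) * TFE T) =
      (F.mean a - F.mean c) * (1 - α) * TFE T := by
    field_simp
  rw [h5] at h4
  have h6 := mul_le_mul_of_nonneg_left h3 (by linarith : (0 : ℝ) ≤ F.mean a - F.mean c)
  linarith

/-- The number of pulls of the changed items which is needed to detect the change. -/
lemma eventually_le_sum_expPulls {W : Finset (Fin L)} {c : ℝ} (hβ : 0 < β)
    (h : ProbablySaving F ν α β TFE π) (h' : ProbablySaving F ν' α β TFE π)
    (hdisj : ∀ᶠ T : ℕ in atTop, ∀ ω,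
      α * oracleSave F ν T (TFE T) ≤ empSave F ν π T (TFE T) ω →
      ¬ α * oracleSave F ν' T (TFE T) ≤ empSave F ν' π T (TFE T) ω)
    (hW : ∀ i ∈ W, ν i = a) (hW' : ∀ i ∈ W, ν' i = c) (heq : ∀ i ∉ W, ν i = ν' i)
    (hac : F.mean c < F.mean a) {ε : ℝ} (hε : 0 < ε) :
    ∀ᶠ T : ℕ in atTop, (β / F.kl a c - ε) * Real.log T ≤
      ∑ i ∈ W, π.expPulls F ν T (TFE T) i := by
  have hk : 0 < F.kl a c := F.kl_pos hac.ne'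
  filter_upwards [eventually_le_sum_expPulls_mul_kl hβ h h' hdisj (mul_pos hε hk)] with T hT
  rw [← Finset.sum_subset (Finset.subset_univ W) fun i _ hi => by
      rw [heq i hi, F.kl_self, mul_zero],
    Finset.sum_congr rfl fun i hi => by rw [hW i hi, hW' i hi], ← Finset.sum_mul] at hT
  refine le_of_mul_le_mul_right (le_of_eq_of_le ?_ hT) hk
  field_simp

end Alternatives

/-! ### Averaging over relabellings of the good items -/

section Labels

lemma card_filter_fin (L m n : ℕ) (h : n ≤ L) :
    (Finset.univ.filter fun i : Fin L => m ≤ (i : ℕ) ∧ (i : ℕ) < n).card = n - m := by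
  rw [Finset.card_filter, Fin.sum_univ_eq_sum_range (fun i => if m ≤ i ∧ i < n then 1 else 0) L,
    ← Finset.card_filter, ← Nat.card_Ico]
  congr 1
  ext i
  simp only [Finset.mem_filter, Finset.mem_range, Finset.mem_Ico]
  omega

lemma card_filter_comp_perm {L : ℕ} (σ : Equiv.Perm (Fin L)) (m n : ℕ) (h : n ≤ L) :
    (Finset.univ.filter fun i : Fin L => m ≤ (σ i : ℕ) ∧ (σ i : ℕ) < n).card = n - m := by
  rw [← card_filter_fin L m n h, Finset.card_filter, Finset.card_filter]
  exact Equiv.sum_comp σ fun i : Fin L => if m ≤ (i : ℕ) ∧ (i : ℕ) < n then 1 else 0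

/-- The cyclic shifts of the first items move each of these equally often to the positions from
`m` on. -/
lemma exists_perms_sum_eq {L Lg Lb : ℕ} (hL : L = Lg + Lb) (hLg : 0 < Lg) {m : ℕ} (hm : m ≤ Lg) :
    ∃ σ : Fin Lg → Equiv.Perm (Fin L), (∀ k i, (σ k i : ℕ) < Lg ↔ (i : ℕ) < Lg) ∧
      ∀ e : Fin L → ℝ,
        ∑ k, ∑ i : Fin L with m ≤ (σ k i : ℕ) ∧ (σ k i : ℕ) < Lg, e i =
          ((Lg : ℝ) - m) * ∑ i ∈ Finset.univ.filter fun i : Fin L => (i : ℕ) < Lg, e i := by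
  subst hL
  have : NeZero Lg := ⟨hLg.ne'⟩
  -- Shift by `k` modulo `Lg` on the good block, and fix every bad item.
  set σ : Fin Lg → Equiv.Perm (Fin (Lg + Lb)) := fun k =>
    finSumFinEquiv.symm.trans ((Equiv.sumCongr (Equiv.addLeft k) (Equiv.refl _)).trans
      finSumFinEquiv) with hσ
  have h1 (k j : Fin Lg) : σ k (Fin.castAdd Lb j) = Fin.castAdd Lb (k + j) := by simp [hσ]
  have h2 (k : Fin Lg) (j : Fin Lb) : σ k (Fin.natAdd Lg j) = Fin.natAdd Lg j := by simp [hσ]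
  refine ⟨σ, fun k i => ?_, fun e => ?_⟩
  · refine Fin.addCases (fun j => ?_) (fun j => ?_) i
    · simp [h1]
    · simp [h2]
  · simp_rw [Finset.sum_filter, Fin.sum_univ_add, h1, h2]
    simp only [Fin.val_castAdd, Fin.val_natAdd, Fin.is_lt, and_true, ↓reduceIte]
    have h3 (j : Fin Lb) : ¬ (Lg + (j : ℕ) < Lg) := by omega
    simp only [h3, and_false, if_false, Finset.sum_const_zero, add_zero]
    rw [Finset.sum_comm, Finset.mul_sum]
    refine Finset.sum_congr rfl fun j _ => ?_
    -- For a fixed item `j`, the map `k ↦ k + j` is a bijection, so exactly `Lg - m` shifts send `j`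
    -- to a position from `m` on.
    have h4 := Equiv.sum_comp (Equiv.addRight j) fun k : Fin Lg =>
      if m ≤ (k : ℕ) then e (Fin.castAdd Lb j) else 0
    simp only [Equiv.coe_addRight] at h4
    refine Eq.trans (b := ∑ k : Fin Lg, if m ≤ (k : ℕ) then e (Fin.castAdd Lb j) else 0)
      (Eq.trans (Finset.sum_congr rfl fun k _ => if_congr Iff.rfl rfl rfl) h4) ?_
    rw [← Finset.sum_filter, Finset.sum_const, nsmul_eq_mul, ← Nat.cast_sub hm,
      ← card_filter_fin Lg m Lg le_rfl]
    simp

/-- If the last `n - m` of the first `n` items have the smallest weights, their weight is at most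
the average one. -/
lemma mul_sum_le_of_forall_le {L m n : ℕ} (hmn : m ≤ n) (hn : n ≤ L) (e : Fin L → ℝ)
    (he : ∀ i j : Fin L, m ≤ (i : ℕ) → (i : ℕ) < n → (j : ℕ) < m → e i ≤ e j) :
    n * ∑ i ∈ Finset.univ.filter fun i : Fin L => m ≤ (i : ℕ) ∧ (i : ℕ) < n, e i ≤
      ((n : ℝ) - m) * ∑ i ∈ Finset.univ.filter fun i : Fin L => (i : ℕ) < n, e i := by
  set C : Finset (Fin L) := Finset.univ.filter fun i => m ≤ (i : ℕ) ∧ (i : ℕ) < n with hC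
  set J : Finset (Fin L) := Finset.univ.filter fun i => 0 ≤ (i : ℕ) ∧ (i : ℕ) < m with hJ
  have hCc : (C.card : ℝ) = n - m := by rw [card_filter_fin L m n hn, Nat.cast_sub hmn]
  have hJc : (J.card : ℝ) = m := by rw [card_filter_fin L 0 m (hmn.trans hn), Nat.sub_zero]
  have hdisj : Disjoint C J := by
    rw [Finset.disjoint_left]
    simp only [hC, hJ, Finset.mem_filter]
    omega
  have hun : (Finset.univ.filter fun i : Fin L => (i : ℕ) < n) = C ∪ J := by
    ext i
    simp only [hC, hJ, Finset.mem_union, Finset.mem_filter, Finset.mem_univ, true_and]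
    omega
  -- Comparing all pairs in `C × J` gives `m * ∑ C ≤ (n - m) * ∑ J`; adding `(n - m) * ∑ C` to both
  -- sides concludes.
  have hle : ∑ i ∈ C, ∑ _j ∈ J, e i ≤ ∑ _i ∈ C, ∑ j ∈ J, e j := by
    refine Finset.sum_le_sum fun i hi => Finset.sum_le_sum fun j hj => ?_
    simp only [hC, hJ, Finset.mem_filter, Finset.mem_univ, true_and] at hi hj
    exact he i j hi.1 hi.2 hj.2
  simp only [Finset.sum_const, nsmul_eq_mul, ← Finset.mul_sum, hCc, hJc] at hle
  rw [hun, Finset.sum_union hdisj]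
  linarith

end Labels

end FreeExploration

/-! ### The regimes of the theorem -/

theorem mainTheorem3 (F : ExpFamily) {L : ℕ} [NeZero L] (Lg Lb : ℕ)
    (hLg : 0 < Lg) (hLb : 0 < Lb) (hL : L = Lg + Lb)
    -- natural parameters of the good and of the bad items of the two-valued instance
    (a b : ℝ) (hab : F.mean b < F.mean a)
    (α β γ : ℝ) (hα : 1 / 2 < α) (hα1 : α < 1) (hβ : 0 < β) (hβ1 : β < 1) (hγ : 0 < γ)
    -- the free exploration budget, asymptotically `γ * Lb * ln T / D(ν_L, ν_1)`
    (TFE : ℕ → ℕ)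
    (hTFE : Tendsto (fun T : ℕ => (TFE T : ℝ) / Real.log T) atTop (𝓝 (γ * Lb / F.kl b a)))
    -- the alternative instance `ν⁽¹⁾`
    (ξ₁ a₁ b₁ : ℝ) (hξ₁ : 0 < ξ₁)
    (ha₁ : F.mean a₁ = (F.mean a + F.mean b - ξ₁) / 2)
    (hb₁ : F.mean b₁ = (F.mean a + F.mean b + ξ₁) / 2)
    (h₁ : ∀ᶠ T : ℕ in atTop, (TFE T : ℝ) ≤ Lg * Real.log T / F.kl a₁ b₁)
    -- the alternative instance `ν⁽³⁾`
    (ξ₃ a₃ : ℝ) (hξ₃ : 0 < ξ₃)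
    (ha₃ : F.mean a₃ = F.mean b - ξ₃)
    (h₃ : ∀ᶠ T : ℕ in atTop, (TFE T : ℝ) ≤ Lg * Real.log T / F.kl a₃ b)
    (ν ν₁ ν₃ : Instance L)
    (hν : ν = twoValued L Lg a b) (hν₁ : ν₁ = twoValued L Lg a₁ b₁)
    (hν₃ : ν₃ = twoValued L Lg a₃ b)
    -- the switching points
    (r₁ r₂ : ℝ)
    (hr₁ : r₁ = β * F.kl b a / (Lb * max (F.kl a a₁) (F.kl b b₁)))
    (hr₂ : r₂ = min (1 + β * F.kl b a / (Lb * F.kl a a₃)) (α / (1 - α))) :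
    -- (i), first regime: no policy is probably-saving
    (γ < r₁ → γ < α / (1 - α) →
      ¬ ∃ π : Policy L, ProbablySaving F ν α β TFE π ∧ ProbablySaving F ν₁ α β TFE π) ∧
    -- (i), second and third regimes
    (∀ π : Policy L, ProbablySaving F ν α β TFE π → ProbablySaving F ν₁ α β TFE π →
      ProbablySaving F ν₃ α β TFE π →
        (r₁ ≤ γ → γ ≤ r₂ → γ < α / (1 - α) →
          limsupSave F ν TFE π ≤
            (F.mean a - F.mean b) * (γ * Lb / F.kl b a - β / F.kl a a₃)) ∧
        (r₂ ≤ γ →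
          limsupSave F ν TFE π ≤ (F.mean a - F.mean b) * (Lb / F.kl b a))) ∧
    -- (ii), for every admissible alternative instance `ν⁽²⁾`
    (∀ π : Policy L, ProbablySaving F ν α β TFE π → ProbablySaving F ν₁ α β TFE π →
      ProbablySaving F ν₃ α β TFE π →
      ∀ (Lg' : ℕ) (ξ₂ c : ℝ) (ν₂ : Instance L), 0 < Lg' → Lg' < Lg →
        (1 - α) / (2 * α - 1) * (F.mean a - F.mean b) < ξ₂ →
        F.mean c = F.mean b - ξ₂ →
        (∀ᶠ T : ℕ in atTop, (TFE T : ℝ) ≤ ((Lg : ℝ) - Lg') * Real.log T / F.kl c a) →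
        ν₂ = threeValued L Lg' Lg a c b →
        -- either `π` is probably-saving on every relabelling of the good items of `ν⁽²⁾`, or it is
        -- so on `ν⁽²⁾`, and the good items are labelled so that the changed ones are pulled least
        ((∀ σ : Equiv.Perm (Fin L), (∀ i, ((σ i : Fin L) : ℕ) < Lg ↔ (i : ℕ) < Lg) →
            ProbablySaving F (ν₂ ∘ σ) α β TFE π) ∨
          (ProbablySaving F ν₂ α β TFE π ∧
            ∀ᶠ T : ℕ in atTop, ∀ i j : Fin L, Lg' ≤ (i : ℕ) → (i : ℕ) < Lg → (j : ℕ) < Lg' →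
              π.expPulls F ν T (TFE T) i ≤ π.expPulls F ν T (TFE T) j)) →
        r₁ ≤ γ → γ ≤ 1 →
          limsupSave F ν TFE π ≤
              (F.mean a - F.mean b) *
                (γ * Lb / F.kl b a - 1 / ((Lg : ℝ) - Lg') * Lg * β / F.kl a c) ∧
          ((Lg : ℝ) - Lg' = max (γ * Lb * F.kl c a / F.kl b a) 1 →
            ∀ ζ : ℝ, ζ = min (F.kl b a / (γ * Lb * F.kl c a)) 1 →
            limsupSave F ν TFE π ≤
              (F.mean a - F.mean b) * (γ * Lb / F.kl b a - ζ * Lg * β / F.kl a c))) := by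
  set B : Finset (Fin L) := Finset.univ.filter fun i => Lg ≤ (i : ℕ) with hBdef
  have hmemB (i : Fin L) : i ∈ B ↔ Lg ≤ (i : ℕ) := by simp [hBdef]
  have hgood : Bᶜ = Finset.univ.filter fun i : Fin L => (i : ℕ) < Lg := by
    ext i; simp [hBdef]
  have hBcc : Bᶜ.card = Lg := by
    have := card_filter_fin L 0 Lg (by omega)
    simpa [hgood] using this
  have hBc : B.card = Lb := by
    have := Finset.card_add_card_compl B
    rw [hBcc, Fintype.card_fin] at this
    omega
  have hBne : B.Nonempty := Finset.card_pos.1 (hBc ▸ hLb)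
  have hex : ∃ i, i ∉ B := by
    obtain ⟨i, hi⟩ := Finset.card_pos.1 (hBcc ▸ hLg : 0 < Bᶜ.card)
    exact ⟨i, Finset.mem_compl.1 hi⟩
  have htwo (x y : ℝ) : (∀ i ∈ B, twoValued L Lg x y i = y) ∧
      ∀ i ∉ B, twoValued L Lg x y i = x :=
    ⟨fun i hi => if_neg (not_lt.2 ((hmemB i).1 hi)),
      fun i hi => if_pos (not_le.1 fun h => hi ((hmemB i).2 h))⟩
  obtain ⟨hb, ha⟩ := hν ▸ htwo a b
  obtain ⟨hb1, ha1⟩ := hν₁ ▸ htwo a₁ b₁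
  obtain ⟨hb3, ha3⟩ := hν₃ ▸ htwo a₃ b
  have hD : 0 < F.kl b a := F.kl_pos hab.ne
  have hLb' : (0 : ℝ) < Lb := Nat.cast_pos.2 hLb
  have hg0 : 0 < γ * Lb / F.kl b a := by positivity
  have hgap : 0 < F.mean a - F.mean b := sub_pos.2 hab
  -- If the minimum is the budget, this is `1 - α < α`; if it is the total need of the bad items, it
  -- is `γ * (1 - α) < α`.
  have hsep : γ < α / (1 - α) →
      (1 - α) * (γ * Lb / F.kl b a) < α * min (γ * Lb / F.kl b a) (B.card / F.kl b a) := by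
    intro h
    rw [lt_div_iff₀ (by linarith)] at h
    have hκ : 0 < (Lb : ℝ) / F.kl b a := by positivity
    rw [hBc, mul_div_assoc]
    rcases min_choice (γ * (Lb / F.kl b a)) (Lb / F.kl b a) with h' | h' <;> rw [h']
    · have : 0 < γ * (Lb / F.kl b a) := by positivity
      nlinarith
    · nlinarith
  have hcard1 : ∀ᶠ T : ℕ in atTop,
      (TFE T : ℝ) ≤ (Bᶜ.card : ℝ) * Real.log T / F.kl a₁ b₁ := by rwa [hBcc]
  have hcard3 : ∀ᶠ T : ℕ in atTop,
      (TFE T : ℝ) ≤ (Bᶜ.card : ℝ) * Real.log T / F.kl a₃ b := by rwa [hBcc]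
  refine ⟨fun hγr hγα => ?_, fun π hπ _ hπ₃ => ⟨fun _ _ hγα => ?_, fun _ => ?_⟩, ?_⟩
  · rintro ⟨π, hπ, hπ₁⟩
    refine absurd hγr (not_lt.2 ?_)
    have hmax : 0 < max (F.kl a a₁) (F.kl b b₁) :=
      lt_max_of_lt_left (F.kl_pos (by linarith))
    have hdisj := eventually_not_saving_of_reversed (π := π) hb ha hex hab hBne hb1 ha1
      (by linarith) hTFE (hsep hγα) hcard1
    -- Each step yields at most the larger divergence and the expected pulls sum to `TFE T`; divide
    -- by `log T` and pass to the limit.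
    have hβle : β ≤ γ * Lb / F.kl b a * max (F.kl a a₁) (F.kl b b₁) := by
      refine le_of_forall_pos_le_add fun ε hε => ?_
      rw [← sub_le_iff_le_add]
      refine ge_of_tendsto (hTFE.mul_const _) ?_
      filter_upwards [eventually_le_sum_expPulls_mul_kl hβ hπ hπ₁ hdisj hε,
        tendsto_log_natCast.eventually_gt_atTop 0] with T hT hl0
      rw [div_mul_eq_mul_div, le_div_iff₀ hl0]
      refine hT.trans ?_
      rw [← π.sum_expPulls F ν T (TFE T), Finset.sum_mul]
      refine Finset.sum_le_sum fun i _ =>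
        mul_le_mul_of_nonneg_left ?_ (π.expPulls_nonneg F ν T _ i)
      by_cases hi : i ∈ B
      · rw [hb i hi, hb1 i hi]; exact le_max_right _ _
      · rw [ha i hi, ha1 i hi]; exact le_max_left _ _
    rw [hr₁, div_le_iff₀ (by positivity)]
    calc β * F.kl b a ≤ γ * Lb / F.kl b a * max (F.kl a a₁) (F.kl b b₁) * F.kl b a :=
          mul_le_mul_of_nonneg_right hβle hD.le
      _ = γ * (Lb * max (F.kl a a₁) (F.kl b b₁)) := by field_simp
  · have hdisj := eventually_not_saving_of_reversed (π := π) hb ha hex hab hBne hb3 ha3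
      (by linarith) hTFE (hsep hγα) hcard3
    exact limsupSave_le_of_forall hTFE hb ha hex hab fun ε hε =>
      eventually_le_sum_expPulls (W := Bᶜ) hβ hπ hπ₃ hdisj
        (fun i hi => ha i (Finset.mem_compl.1 hi)) (fun i hi => ha3 i (Finset.mem_compl.1 hi))
        (fun i hi => by
          have hi' : i ∈ B := by simpa using hi
          rw [hb i hi', hb3 i hi']) (by linarith) hε
  · have := limsupSave_le_card (π := π) (TFE := TFE) hb ha hex hab
    rwa [hBc] at this
  · intro π hπ _ _ Lg' ξ₂ c ν₂ hLg' hLg'g hξ₂ hc h₂ hν₂ hcase _ hγ1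
    have hac : F.mean c < F.mean b := by
      have : 0 ≤ (1 - α) / (2 * α - 1) * (F.mean a - F.mean b) :=
        mul_nonneg (div_nonneg (by linarith) (by linarith)) hgap.le
      linarith
    have hk : 0 < F.kl a c := F.kl_pos (hac.trans hab).ne'
    have hLc : (0 : ℝ) < (Lg : ℝ) - Lg' := sub_pos.2 (Nat.cast_lt.2 hLg'g)
    have hLgR : (0 : ℝ) < Lg := Nat.cast_pos.2 hLg
    -- Stated for a general relabelling so that the cyclic shifts and the identity, used in the two
    -- cases of `hcase`, are covered at once.
    have hchange (σ : Equiv.Perm (Fin L)) (hσ : ∀ i, ((σ i : Fin L) : ℕ) < Lg ↔ (i : ℕ) < Lg)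
        (hσπ : ProbablySaving F (ν₂ ∘ σ) α β TFE π) {ε : ℝ} (hε : 0 < ε) :
        ∀ᶠ T : ℕ in atTop, (β / F.kl a c - ε) * Real.log T ≤
          ∑ i with Lg' ≤ (σ i : ℕ) ∧ (σ i : ℕ) < Lg, π.expPulls F ν T (TFE T) i := by
      set W : Finset (Fin L) :=
        Finset.univ.filter fun i => Lg' ≤ (σ i : ℕ) ∧ (σ i : ℕ) < Lg with hWdef
      have hmemW (i : Fin L) : i ∈ W ↔ Lg' ≤ (σ i : ℕ) ∧ (σ i : ℕ) < Lg := by simp [hWdef]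
      have hWc : W.card = Lg - Lg' := card_filter_comp_perm σ Lg' Lg (by omega)
      have hWc' : (W.card : ℝ) = (Lg : ℝ) - Lg' := by rw [hWc, Nat.cast_sub hLg'g.le]
      have hWB : Disjoint W B := by
        rw [Finset.disjoint_left]
        intro i hi hi'
        have h1 := ((hmemW i).1 hi).2
        have h2 := (hmemB i).1 hi'
        have h3 := hσ i
        omega
      have hWa (i : Fin L) (hi : i ∈ W) : ν i = a := ha i (Finset.disjoint_left.1 hWB hi)
      have hc' : ∀ i ∈ W, (ν₂ ∘ σ) i = c := by
        intro i hi
        have h1 := (hmemW i).1 hi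
        simp only [Function.comp_apply, hν₂, threeValued]
        rw [if_neg (by omega), if_pos (by omega)]
      have hb' : ∀ i ∈ B, (ν₂ ∘ σ) i = b := by
        intro i hi
        have h1 := (hmemB i).1 hi
        have h3 := hσ i
        simp only [Function.comp_apply, hν₂, threeValued]
        rw [if_neg (by omega), if_neg (by omega)]
      have ha' : ∀ i, i ∉ W → i ∉ B → (ν₂ ∘ σ) i = a := by
        intro i hi hi'
        rw [hmemW] at hi
        rw [hmemB] at hi'
        have h3 := hσ i
        simp only [Function.comp_apply, hν₂, threeValued]
        rw [if_pos (by omega)]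
      have hexW : ∃ i, i ∉ W ∧ i ∉ B := by
        -- Position `0` keeps the parameter `a` because `0 < Lg'`.
        refine ⟨σ.symm 0, ?_, ?_⟩
        · rw [hmemW, Equiv.apply_symm_apply, Fin.val_zero]
          omega
        · have h3 := hσ (σ.symm 0)
          rw [Equiv.apply_symm_apply, Fin.val_zero] at h3
          rw [hmemB]
          omega
      have hWne : W.Nonempty := Finset.card_pos.1 (by omega)
      have hgle : γ * Lb / F.kl b a ≤ B.card / F.kl b a := by
        rw [hBc]
        exact div_le_div_of_nonneg_right (mul_le_of_le_one_left hLb'.le hγ1) hD.le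
      have hdisj := eventually_not_saving_of_three (π := π) hb ha hab hBne hc' hb' ha' hexW hWB
        hWne hα (by rw [hc]; linarith) hac hg0 hTFE hgle (by rwa [hWc'])
      refine eventually_le_sum_expPulls hβ hπ hσπ hdisj hWa hc' (fun i hi => ?_)
        (hac.trans hab) hε
      by_cases hi' : i ∈ B
      · rw [hb i hi', hb' i hi']
      · rw [ha i hi', ha' i hi hi']
    have hmain : ∀ ε > 0, ∀ᶠ T : ℕ in atTop,
        (1 / ((Lg : ℝ) - Lg') * Lg * β / F.kl a c - ε) * Real.log T ≤
          ∑ i ∈ Bᶜ, π.expPulls F ν T (TFE T) i := by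
      intro ε hε
      -- Chosen so that the final factor `Lg / (Lg - Lg')` turns the loss `δ` into `ε`.
      set δ := ε * ((Lg : ℝ) - Lg') / Lg with hδ
      have hδ0 : 0 < δ := by positivity
      suffices h : ∀ᶠ T : ℕ in atTop, Lg * ((β / F.kl a c - δ) * Real.log T) ≤
          ((Lg : ℝ) - Lg') *
            ∑ i ∈ Finset.univ.filter fun i : Fin L => (i : ℕ) < Lg, π.expPulls F ν T (TFE T) i by
        filter_upwards [h] with T hT
        rw [hgood]
        refine le_of_mul_le_mul_left (le_of_eq_of_le ?_ hT) hLc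
        rw [hδ]
        field_simp
      rcases hcase with hperm | ⟨hπ₂, hord⟩
      · obtain ⟨σ, hσ, hsum⟩ := exists_perms_sum_eq hL hLg hLg'g.le
        filter_upwards [eventually_all.2 fun k => hchange (σ k) (hσ k) (hperm _ (hσ k)) hδ0]
          with T hT
        rw [← hsum]
        refine le_of_eq_of_le ?_ (Finset.sum_le_sum fun k _ => hT k)
        simp
      · filter_upwards [hord, hchange (Equiv.refl _) (fun _ => Iff.rfl) hπ₂ hδ0] with T hT hT'
        exact (mul_le_mul_of_nonneg_left hT' hLgR.le).trans
          (mul_sum_le_of_forall_le hLg'g.le (by omega) _ hT)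
    have hfin := limsupSave_le_of_forall hTFE hb ha hex hab hmain
    refine ⟨hfin, fun hmax ζ hζ => ?_⟩
    have hk' : 0 < F.kl c a := F.kl_pos (hac.trans hab).ne
    -- Inversion exchanges `max x 1` and `min x⁻¹ 1` for positive `x`.
    have hζ' : ζ = 1 / ((Lg : ℝ) - Lg') := by
      rw [hζ, hmax, ← inv_div (γ * Lb * F.kl c a) (F.kl b a), one_div]
      have hx : 0 < γ * Lb * F.kl c a / F.kl b a := by positivity
      rcases le_total (γ * Lb * F.kl c a / F.kl b a) 1 with h | h
      · rw [max_eq_right h, inv_one, min_eq_right ((one_le_inv₀ hx).2 h)]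
      · rw [max_eq_left h, min_eq_left (inv_le_one_of_one_le₀ h)]
    rw [hζ']
    exact hfin
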